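/- Let $G=(V,E)$ be a finite simple graph with maximum degree $\Delta$, let $A_G$ be its adjacency matrix with smallest eigenvalue $\lambda_{\min}(A_G)$, and let $1\le k\le |V|$. Let $I_{G,k}=\{S\subseteq V : S \text{ independent in } G,\ |S|\le k\}$, and for $S \in I_{G,k}$ say that $S$ has dimension $|S|-1$; put $X(j)=\{S\in I_{G,k}: |S|=j+1\}$. Let $\Pi_{k-1}$ be the uniform distribution on $X(k-1)$, and let $$\Pi_{j}(\alpha)=\frac1{j+2}\sum_{\beta\in X(j+1),\,\beta\supset\alpha}\Pi_{j+1}(\beta)\qquad(\alpha\in X(j),\ -1\le j\le k-2).$$ The $j$-th down-up walk is the matrix $W_j=U_{j-1}D_j$ on $\mathbb R^{X(j)}$, where $$[U_{j-1}f](\beta)=\frac1{j+1}\sum_{\alpha\in X(j-1),\,\alpha\subset\beta}f(\alpha),\qquad [D_jg](\alpha)=\sum_{\beta\in X(j),\,\beta\supset\alpha}\frac{\Pi_j(\beta)}{(j+1)\,\Pi_{j-1}(\alpha)}\,g(\beta).$$ (Thus $W_{k-1}$ is the transition matrix of the chain on the independent sets of size $k$ that deletes a uniformly random vertex from the current set and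 then moves to a uniformly random independent set of size $k$ containing the remaining set.) If $k\,(\Delta+|\lambda_{\min}(A_G)|)\le |V|$ (that is, $k\le \frac{|V|}{\Delta+|\lambda_{\min}(A_G)|}$ when $G$ has at least one edge), then every inclusion-maximal element of $I_{G,k}$ has exactly $k$ elements, all eigenvalues of $W_{k-1}$ are real, and the second largest eigenvalue of $W_{k-1}$, counted with multiplicity (if $|X(k-1)|\ge 2$), satisfies $$\lambda_2(W_{k-1})\le 1-\frac1{k^2}.$$ -/

import Mathlib

noncomputable section

namespace HDX

section Eigenvalues

variable {n : Type*} [Fintype n] [DecidableEq n]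

/-- The list of the real eigenvalues of a square real matrix, repeated according to their
multiplicity as roots of the characteristic polynomial, in non-increasing order. -/
def eigenvalueList (M : Matrix n n ℝ) : List ℝ :=
  M.charpoly.roots.sort (fun a b => a ≥ b)

/-- All eigenvalues of `M` are real, i.e. `M` has as many real eigenvalues, counted with
multiplicity, as it has rows. -/
def HasRealSpectrum (M : Matrix n n ℝ) : Prop :=
  (eigenvalueList M).length = Fintype.card n

/-- The `i`-th largest eigenvalue `λ_i(M)`, for `1 ≤ i ≤ |n|`, counted with multiplicity
(with the convention `0` if there is no such eigenvalue). -/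
def eigenvalue (M : Matrix n n ℝ) (i : ℕ) : ℝ :=
  (eigenvalueList M).getD (i - 1) 0

/-- The smallest eigenvalue `λ_min(M) = λ_{|n|}(M)`. -/
def eigenvalueMin (M : Matrix n n ℝ) : ℝ :=
  eigenvalue M (Fintype.card n)

end Eigenvalues

/-- A finite simplicial complex on the ground set `V`: a downward closed family of subsets.
As usual for higher order random walks, the empty set is allowed as a face. -/
structure Complex (V : Type*) where
  faces : Finset (Finset V)
  down_closed : ∀ β ∈ faces, ∀ α : Finset V, α ⊆ β → α ∈ faces

namespace Complex

variable {V : Type*} [DecidableEq V] (X : Complex V)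

/-- The faces of cardinality `m`, that is, of dimension `m - 1`. -/
def facesOfCard (m : ℕ) : Finset (Finset V) :=
  {α ∈ X.faces | α.card = m}

/-- The type of faces of cardinality `m`, i.e. `X(m - 1)`. -/
abbrev Face (m : ℕ) : Type _ :=
  {α : Finset V // α ∈ X.facesOfCard m}

/-- `X` is pure with maximal faces of cardinality `r` (so of dimension `r - 1`): it is non-empty
and every inclusion-maximal face has cardinality `r`. -/
def IsPure (r : ℕ) : Prop :=
  X.faces.Nonempty ∧ ∀ α ∈ X.faces, (∀ β ∈ X.faces, α ⊆ β → β = α) → α.card = r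

/-- The uniform distribution on the faces of cardinality `r`. -/
def uniformWeight (r : ℕ) (α : Finset V) : ℝ :=
  if α ∈ X.facesOfCard r then 1 / ((X.facesOfCard r).card : ℝ) else 0

/-- The marginals of a distribution `w` on top-dimensional faces, indexed by codimension `t`:
in codimension `0` it is `w`, and
`Π_j(α) = (1 / (j + 2)) ∑_{β ∈ X(j+1), β ⊇ α} Π_{j+1}(β)`, where `j + 2 = |α| + 1`. -/
def marginalOfCodim (w : Finset V → ℝ) : ℕ → Finset V → ℝ
  | 0 => w
  | t + 1 => fun α =>
      1 / ((α.card : ℝ) + 1) *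
        ∑ β ∈ X.facesOfCard (α.card + 1) with α ⊆ β, marginalOfCodim w t β

/-- The induced distribution on the faces of cardinality `m`, i.e. `Π_{m-1}`, where `w` is a
distribution on the top faces, which have cardinality `r`. -/
def marginal (w : Finset V → ℝ) (r m : ℕ) (α : Finset V) : ℝ :=
  X.marginalOfCodim w (r - m) α

/-- The up operator `U_{j-1} : ℝ^{X(j-1)} → ℝ^{X(j)}`; here `X(j)` consists of the faces of
cardinality `j + 1`. -/
def upOperator (j : ℕ) : Matrix (X.Face (j + 1)) (X.Face j) ℝ :=
  fun β α => if α.1 ⊆ β.1 then 1 / ((j : ℝ) + 1) else 0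

/-- The down operator `D_j : ℝ^{X(j)} → ℝ^{X(j-1)}` of the complex with distribution `w` on the
top faces of cardinality `r`. -/
def downOperator (w : Finset V → ℝ) (r j : ℕ) : Matrix (X.Face j) (X.Face (j + 1)) ℝ :=
  fun α β =>
    if α.1 ⊆ β.1 then
      X.marginal w r (j + 1) β.1 / (((j : ℝ) + 1) * X.marginal w r j α.1)
    else 0

/-- The `j`-th down-up walk `U_{j-1} D_j`, a random walk on `X(j)`. -/
def downUpWalk (w : Finset V → ℝ) (r j : ℕ) : Matrix (X.Face (j + 1)) (X.Face (j + 1)) ℝ :=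
  X.upOperator j * X.downOperator w r j

end Complex

section IndependentSets

variable {V : Type*} [Fintype V] [DecidableEq V]

open Classical in
/-- The complex `I_{G,k}` of all independent sets of `G` with at most `k` vertices. -/
def independentSetComplex (G : SimpleGraph V) (k : ℕ) : Complex V where
  faces := {S : Finset V | G.IsIndepSet (S : Set V) ∧ S.card ≤ k}
  down_closed := by
    intro β hβ α hα
    simp only [Finset.mem_filter, Finset.mem_univ, true_and] at hβ ⊢
    exact ⟨hβ.1.mono (by exact_mod_cast hα), (Finset.card_le_card hα).trans hβ.2⟩

/-- The `(k-1)`-th down-up walk on `I_{G,k}`, endowed with the uniform distribution on the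
independent sets of size `k`. -/
def independentSetWalk (G : SimpleGraph V) (k : ℕ) :
    Matrix ((independentSetComplex G k).Face (k - 1 + 1))
      ((independentSetComplex G k).Face (k - 1 + 1)) ℝ :=
  (independentSetComplex G k).downUpWalk ((independentSetComplex G k).uniformWeight k) k (k - 1)

end IndependentSets

end HDX

end

/-! ### Eigenvalues of real symmetric matrices and their quadratic forms. -/

section Spectral

variable {n : Type*} [Fintype n] [DecidableEq n]

open scoped Matrix

/-! Take a uniformly random independent `k`-set and a random `m`-subset of it. Let `M_m`
(`levelMoment`) be, up to a constant factor, the second moment of the conditional mean of `f` given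
that subset. The walk matrix is symmetric, with quadratic form `M_{k-1}` and `M_k = ‖f‖²`, while
`M_0 = 0` if `f` has sum zero. So the spectral bound amounts to `M_k - M_0 ≤ k² (M_k - M_{k-1})`.

This follows from local information. If the weighted link graph of each `j`-set has second
eigenvalue at most `γ`, then passing from edges to vertices of the links contracts variance by `(1 +
γ)/2` (`SecondEigenvalueLE.variance_contraction`, summed up in `levelMoment_step`). With `γ =
1/(j+2)` these inequalities combine to exactly the factor `k²` (`levelMoment_gap`).

The local bounds descend from codimension two by Oppenheim's trickling down (`trickle_down`): for
connected links a bound `γ` one level up becomes `γ/(1-γ)`, which turns `1/(j+3)` into `1/(j+2)`. It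
remains to prove `1/k` for `|α| = k - 2` (`secondEigenvalueLE_codim_two`). There the link is the
complement of `G` outside the closed neighbourhood of `α`. On vectors of sum zero its form is at
most `(|λ_min| - 1)‖·‖²`, and the hypothesis makes all its degrees at least `k(|λ_min| - 1)`. The
hypothesis also gives `k(Δ+1) ≤ |V|`, whence purity and connectedness of the links. -/

/-- The real spectral theorem in coordinates, with the eigenvalues given by the roots of the
characteristic polynomial. -/
theorem exists_orthonormal_eigenvectors (A : Matrix n n ℝ) (hA : A.IsSymm) :
    ∃ (μ : n → ℝ) (e : n → n → ℝ), A.charpoly.roots = Finset.univ.val.map μ ∧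
      (∀ i, A *ᵥ e i = μ i • e i) ∧
      (∀ i j, e i ⬝ᵥ e j = if i = j then 1 else 0) ∧
      ∀ x y : n → ℝ, x ⬝ᵥ y = ∑ i, (e i ⬝ᵥ x) * (e i ⬝ᵥ y) := by
  have hH : A.IsHermitian := by
    rw [Matrix.IsHermitian, Matrix.conjTranspose_eq_transpose_of_trivial]; exact hA
  refine ⟨hH.eigenvalues, fun i => (hH.eigenvectorBasis i).ofLp, ?_, ?_, ?_, ?_⟩
  · simpa using hH.roots_charpoly_eq_eigenvalues
  · intro i
    exact hH.mulVec_eigenvectorBasis i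
  · intro i j
    have h := (orthonormal_iff_ite.mp hH.eigenvectorBasis.orthonormal) i j
    rw [EuclideanSpace.inner_eq_star_dotProduct] at h
    rw [dotProduct_comm]
    simpa using h
  · intro x y
    have h := hH.eigenvectorBasis.sum_inner_mul_inner (WithLp.toLp 2 x) (WithLp.toLp 2 y)
    simp only [EuclideanSpace.inner_eq_star_dotProduct, star_trivial] at h
    rw [dotProduct_comm x y, ← h]
    refine Finset.sum_congr rfl fun i _ => ?_
    rw [dotProduct_comm y]

omit [DecidableEq n] in
theorem symm_dotProduct_mulVec {A : Matrix n n ℝ} (hA : A.IsSymm) (x y : n → ℝ) :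
    x ⬝ᵥ A *ᵥ y = (A *ᵥ x) ⬝ᵥ y := by
  rw [Matrix.dotProduct_mulVec, ← Matrix.mulVec_transpose, hA.eq]

theorem hasRealSpectrum_of_isSymm (A : Matrix n n ℝ) (hA : A.IsSymm) :
    HDX.HasRealSpectrum A := by
  obtain ⟨μ, e, hr, -⟩ := exists_orthonormal_eigenvectors A hA
  simp [HDX.HasRealSpectrum, HDX.eigenvalueList, hr]

omit [DecidableEq n] in
theorem dotProduct_mulVec_eq_sum {A : Matrix n n ℝ} (hA : A.IsSymm) {μ : n → ℝ}
    {e : n → n → ℝ} (hev : ∀ i, A *ᵥ e i = μ i • e i)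
    (hpars : ∀ x y : n → ℝ, x ⬝ᵥ y = ∑ i, (e i ⬝ᵥ x) * (e i ⬝ᵥ y)) (x : n → ℝ) :
    x ⬝ᵥ A *ᵥ x = ∑ i, μ i * (e i ⬝ᵥ x) ^ 2 := by
  rw [hpars]
  refine Finset.sum_congr rfl fun i _ => ?_
  rw [symm_dotProduct_mulVec hA, hev, smul_dotProduct, smul_eq_mul]
  ring

theorem eigenvalueMin_mul_le (A : Matrix n n ℝ) (hA : A.IsSymm) (x : n → ℝ) :
    HDX.eigenvalueMin A * (x ⬝ᵥ x) ≤ x ⬝ᵥ A *ᵥ x := by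
  obtain ⟨μ, e, hr, hev, -, hpars⟩ := exists_orthonormal_eigenvectors A hA
  rw [dotProduct_mulVec_eq_sum hA hev hpars, hpars x x, Finset.mul_sum]
  refine Finset.sum_le_sum fun i _ => ?_
  rw [← pow_two]
  refine mul_le_mul_of_nonneg_right ?_ (sq_nonneg _)
  have hlen : (HDX.eigenvalueList A).length = Fintype.card n := hasRealSpectrum_of_isSymm A hA
  have hmem : μ i ∈ HDX.eigenvalueList A := by
    simp [HDX.eigenvalueList, hr]
  have hsort : (HDX.eigenvalueList A).Pairwise (fun a b => a ≥ b) := Multiset.pairwise_sort _ _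
  obtain ⟨m, hm, hmi⟩ := List.getElem_of_mem hmem
  have hlast : Fintype.card n - 1 < (HDX.eigenvalueList A).length := by omega
  rw [HDX.eigenvalueMin, HDX.eigenvalue, List.getD_eq_getElem _ _ hlast, ← hmi]
  rcases Nat.lt_or_ge m (Fintype.card n - 1) with h | h
  · exact List.pairwise_iff_getElem.mp hsort m _ hm hlast h
  · have : m = Fintype.card n - 1 := by omega
    subst this
    exact le_rfl

/-- A one-constraint case of the Courant-Fischer bound on the second eigenvalue. -/
theorem eigenvalue_two_le (A : Matrix n n ℝ) (hA : A.IsSymm) (u : n → ℝ) (b : ℝ) (hb : 0 ≤ b)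
    (h : ∀ f : n → ℝ, u ⬝ᵥ f = 0 → f ⬝ᵥ A *ᵥ f ≤ b * (f ⬝ᵥ f)) :
    HDX.eigenvalue A 2 ≤ b := by
  obtain ⟨μ, e, hr, hev, hon, -⟩ := exists_orthonormal_eigenvectors A hA
  by_contra! hlt
  have hcount : 2 ≤ (HDX.eigenvalueList A).countP (fun a => b < a) := by
    have hsort : (HDX.eigenvalueList A).Pairwise (fun a b => a ≥ b) := Multiset.pairwise_sort _ _
    unfold HDX.eigenvalue at hlt
    -- With fewer than two eigenvalues the default value `0` is returned; this is where `hb` enters.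
    rcases hl : HDX.eigenvalueList A with _ | ⟨a, _ | ⟨c, t⟩⟩
    · rw [hl] at hlt; simp at hlt; linarith
    · rw [hl] at hlt; simp at hlt; linarith
    · rw [hl] at hlt hsort
      simp at hlt
      simp only [List.pairwise_cons, List.mem_cons] at hsort
      have : c ≤ a := hsort.1 c (Or.inl rfl)
      rw [List.countP_cons_of_pos (by simpa using lt_of_lt_of_le hlt this),
        List.countP_cons_of_pos (by simpa using hlt)]
      omega
  have hcard : 1 < (Finset.univ.filter fun i => b < μ i).card := by
    have h1 : ((HDX.eigenvalueList A : List ℝ) : Multiset ℝ) = Finset.univ.val.map μ := by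
      rw [HDX.eigenvalueList, Multiset.sort_eq, hr]
    have h2 : (HDX.eigenvalueList A).countP (fun a => b < a)
        = Multiset.countP (fun a => b < a) (Finset.univ.val.map μ) := by
      rw [← h1, Multiset.coe_countP]
    rw [h2, Multiset.countP_map] at hcount
    exact hcount
  obtain ⟨i, hi, j, hj, hij⟩ := Finset.one_lt_card.mp hcard
  simp only [Finset.mem_filter, Finset.mem_univ, true_and] at hi hj
  have key : ∀ p q : ℝ, u ⬝ᵥ (p • e i + q • e j) = 0 →
      μ i * p ^ 2 + μ j * q ^ 2 ≤ b * (p ^ 2 + q ^ 2) := by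
    intro p q hpq
    have := h _ hpq
    simp only [Matrix.mulVec_add, Matrix.mulVec_smul, hev, add_dotProduct, dotProduct_add,
      smul_dotProduct, dotProduct_smul, hon, hij, hij.symm, if_true, if_false, smul_eq_mul] at this
    linarith
  simp only [dotProduct_add, dotProduct_smul, smul_eq_mul] at key
  -- The span of two eigenvectors with eigenvalues above `b` contains a nonzero vector orthogonal to
  -- `u`.
  by_cases hz : u ⬝ᵥ e i = 0
  · have := key 1 0 (by simp [hz])
    linarith
  · have := key (u ⬝ᵥ e j) (-(u ⬝ᵥ e i)) (by ring)
    have h1 : 0 < (u ⬝ᵥ e i) ^ 2 := by positivity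
    nlinarith [sq_nonneg (u ⬝ᵥ e j)]

end Spectral

/-! ### Weighted graphs: trickling down and contraction of variance. -/

section WeightedGraph

open scoped Matrix

variable {V : Type*} [Fintype V]

/-- The random walk on the weighted graph `w` has second eigenvalue at most `γ`, expressed by
quadratic forms. -/
def SecondEigenvalueLE (w : V → V → ℝ) (γ : ℝ) : Prop :=
  ∀ g : V → ℝ, ∑ x, (∑ y, w x y) * g x = 0 →
    ∑ x, ∑ y, w x y * g x * g y ≤ γ * ∑ x, (∑ y, w x y) * g x ^ 2

theorem sum_symm_weight {w : V → V → ℝ} (hs : ∀ x y, w x y = w y x) (g : V → ℝ) :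
    ∑ x, ∑ y, w x y * g y = ∑ x, (∑ y, w x y) * g x := by
  rw [Finset.sum_comm]
  refine Finset.sum_congr rfl fun x _ => ?_
  rw [Finset.sum_mul]
  exact Finset.sum_congr rfl fun y _ => by rw [hs]

theorem sum_weight_sq_sub {w : V → V → ℝ} (hs : ∀ x y, w x y = w y x) (g : V → ℝ) :
    ∑ x, ∑ y, w x y * (g x - g y) ^ 2
      = 2 * ∑ x, (∑ y, w x y) * g x ^ 2 - 2 * ∑ x, ∑ y, w x y * g x * g y := by
  have h1 := sum_symm_weight hs (fun x => g x ^ 2)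
  have h2 : ∑ x, ∑ y, w x y * g x ^ 2 = ∑ x, (∑ y, w x y) * g x ^ 2 := by
    simp only [Finset.sum_mul]
  have : ∀ x y, w x y * (g x - g y) ^ 2
      = w x y * g x ^ 2 + w x y * g y ^ 2 - 2 * (w x y * g x * g y) := fun x y => by ring
  simp only [this, Finset.sum_sub_distrib, Finset.sum_add_distrib, ← Finset.mul_sum, h1, h2]
  ring

theorem sum_weight_sq_add {w : V → V → ℝ} (hs : ∀ x y, w x y = w y x) (g : V → ℝ) :
    ∑ x, ∑ y, w x y * (g x + g y) ^ 2
      = 2 * ∑ x, (∑ y, w x y) * g x ^ 2 + 2 * ∑ x, ∑ y, w x y * g x * g y := by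
  have h1 := sum_symm_weight hs (fun x => g x ^ 2)
  have h2 : ∑ x, ∑ y, w x y * g x ^ 2 = ∑ x, (∑ y, w x y) * g x ^ 2 := by
    simp only [Finset.sum_mul]
  have : ∀ x y, w x y * (g x + g y) ^ 2
      = w x y * g x ^ 2 + w x y * g y ^ 2 + 2 * (w x y * g x * g y) := fun x y => by ring
  simp only [this, Finset.sum_add_distrib, ← Finset.mul_sum, h1, h2]
  ring

theorem weight_eq_zero_of_degree {w : V → V → ℝ} (hn : ∀ x y, 0 ≤ w x y) {x : V}
    (hx : ∑ y, w x y = 0) (y : V) : w x y = 0 :=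
  (Finset.sum_eq_zero_iff_of_nonneg fun y _ => hn x y).mp hx y (Finset.mem_univ y)

/-- The quadratic form bound without the orthogonality constraint. -/
theorem SecondEigenvalueLE.quadratic_le {w : V → V → ℝ} {γ : ℝ} (hs : ∀ x y, w x y = w y x)
    (hn : ∀ x y, 0 ≤ w x y) (h : SecondEigenvalueLE w γ) (g : V → ℝ) :
    ∑ x, ∑ y, w x y * g x * g y ≤
      (1 - γ) * ((∑ x, (∑ y, w x y) * g x) ^ 2 / ∑ x, ∑ y, w x y)
        + γ * ∑ x, (∑ y, w x y) * g x ^ 2 := by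
  set D := ∑ x, ∑ y, w x y with hD
  set M := ∑ x, (∑ y, w x y) * g x with hM
  by_cases hD0 : D = 0
  · have hd : ∀ x, ∑ y, w x y = 0 := fun x =>
      (Finset.sum_eq_zero_iff_of_nonneg fun x _ => Finset.sum_nonneg fun y _ => hn x y).mp hD0 x
        (Finset.mem_univ x)
    have hw : ∀ x y, w x y = 0 := fun x y => weight_eq_zero_of_degree hn (hd x) y
    simp [hD0, hw]
  -- Subtract the degree-weighted mean `c`, so that the constrained bound applies.
  · set c := M / D with hc
    have hcD : c * D = M := by rw [hc]; field_simp
    have h0 : ∑ x, (∑ y, w x y) * (g x - c) = 0 := by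
      simp only [mul_sub, Finset.sum_sub_distrib, ← Finset.sum_mul]
      rw [← hM, ← hD]; linarith
    have h1 := h _ h0
    have h2 : ∑ x, (∑ y, w x y) * (g x - c) ^ 2
        = ∑ x, (∑ y, w x y) * g x ^ 2 - 2 * c * M + c ^ 2 * D := by
      have : ∀ x, (∑ y, w x y) * (g x - c) ^ 2 = (∑ y, w x y) * g x ^ 2
        - 2 * c * ((∑ y, w x y) * g x) + c ^ 2 * ∑ y, w x y := fun x => by ring
      simp only [this, Finset.sum_sub_distrib, Finset.sum_add_distrib, ← Finset.mul_sum, ← hM, ← hD]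
    have h3 : ∑ x, ∑ y, w x y * (g x - c) * (g y - c)
        = ∑ x, ∑ y, w x y * g x * g y - 2 * c * M + c ^ 2 * D := by
      have e1 := sum_symm_weight hs g
      have e2 : ∑ x, ∑ y, w x y * g x = M := by simp only [hM, Finset.sum_mul]
      have : ∀ x y, w x y * (g x - c) * (g y - c) = w x y * g x * g y
        - c * (w x y * g x) - c * (w x y * g y) + c ^ 2 * w x y := fun x y => by ring
      simp only [this, Finset.sum_sub_distrib, Finset.sum_add_distrib, ← Finset.mul_sum, ← hD, e1,
        e2, ← hM]
      ring
    rw [h2, h3] at h1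
    have h4 : M ^ 2 / D = c * M := by rw [hc]; ring
    have h5 : c ^ 2 * D = c * M := by rw [pow_two, mul_assoc, hcD]
    rw [h4]
    rw [h5] at h1
    linarith

/-- Oppenheim's trickle-down step for a connected weighted graph. -/
theorem trickle_down [DecidableEq V] {w : V → V → ℝ} {γ : ℝ} (hs : ∀ x y, w x y = w y x)
    (hn : ∀ x y, 0 ≤ w x y) (hγ0 : 0 ≤ γ) (hγ1 : γ < 1)
    (hconn : ∀ g : V → ℝ, (∀ x y, 0 < w x y → g x = g y) →
      ∃ c, ∀ x, 0 < ∑ y, w x y → g x = c)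
    (hloc : ∀ g : V → ℝ, ∑ x, ∑ y, w x y * g x * g y ≤
      (1 - γ) * ∑ x, (∑ y, w x y * g y) ^ 2 / (∑ y, w x y)
        + γ * ∑ x, (∑ y, w x y) * g x ^ 2) :
    SecondEigenvalueLE w (γ / (1 - γ)) := by
  intro h hmean
  set d : V → ℝ := fun x => ∑ y, w x y with hd
  have hd0 : ∀ x, 0 ≤ d x := fun x => Finset.sum_nonneg fun y _ => hn x y
  have hsq : ∀ x, √(d x) ^ 2 = d x := fun x => Real.sq_sqrt (hd0 x)
  have hwz : ∀ x y, √(d x) = 0 → w x y = 0 := fun x y hx =>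
    weight_eq_zero_of_degree hn ((Real.sqrt_eq_zero (hd0 x)).mp hx) y
  -- Symmetric normalisation of the random walk. Vertices of degree zero give zero rows since `x / 0
  -- = 0`, which is why `hdeg` is only an inequality.
  let S : Matrix V V ℝ := fun x y => w x y / (√(d x) * √(d y))
  have hS : S.IsSymm := by
    ext x y
    change w y x / (√(d y) * √(d x)) = w x y / (√(d x) * √(d y))
    rw [hs, mul_comm]
  obtain ⟨μ, e, -, hev, hon, hpars⟩ := exists_orthonormal_eigenvectors S hS
  have hquad : ∀ v : V → ℝ, ∑ x, ∑ y, w x y * (v x / √(d x)) * (v y / √(d y))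
      = v ⬝ᵥ S *ᵥ v := by
    intro v
    simp only [dotProduct, Matrix.mulVec, Finset.mul_sum, S]
    exact Finset.sum_congr rfl fun x _ => Finset.sum_congr rfl fun y _ => by ring
  have hdeg : ∀ v : V → ℝ, ∑ x, d x * (v x / √(d x)) ^ 2 ≤ v ⬝ᵥ v := by
    intro v
    refine Finset.sum_le_sum fun x _ => ?_
    by_cases hx : √(d x) = 0
    · simp [hx, mul_self_nonneg]
    · rw [div_pow, hsq]
      rw [← mul_div_assoc, mul_div_cancel_left₀ _ (by rw [← hsq]; exact pow_ne_zero 2 hx), pow_two]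
  have hnorm : ∀ v : V → ℝ, ∑ x, (∑ y, w x y * (v y / √(d y))) ^ 2 / d x
      = (S *ᵥ v) ⬝ᵥ (S *ᵥ v) := by
    intro v
    refine Finset.sum_congr rfl fun x _ => ?_
    have : (S *ᵥ v) x = (∑ y, w x y * (v y / √(d y))) / √(d x) := by
      simp only [Matrix.mulVec, dotProduct, S, Finset.sum_div]
      exact Finset.sum_congr rfl fun y _ => by ring
    rw [this, ← pow_two, div_pow, hsq]
  have hμ : ∀ i, μ i ≤ γ / (1 - γ) ∨ e i ⬝ᵥ (fun x => √(d x) * h x) = 0 := by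
    intro i
    have hii : e i ⬝ᵥ e i = 1 := by simp [hon]
    have hq : ∑ x, ∑ y, w x y * (e i x / √(d x)) * (e i y / √(d y)) = μ i := by
      rw [hquad, hev, dotProduct_smul, hii]; simp
    have hdg := hdeg (e i)
    rw [hii] at hdg
    have hl := hloc (fun x => e i x / √(d x))
    rw [hq] at hl
    have hnm := hnorm (e i)
    rw [hev, smul_dotProduct, dotProduct_smul, hii] at hnm
    simp only [smul_eq_mul, mul_one] at hnm
    change μ i ≤ (1 - γ) * (∑ x, (∑ y, w x y * (e i y / √(d y))) ^ 2 / d x)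
      + γ * ∑ x, d x * (e i x / √(d x)) ^ 2 at hl
    rw [hnm] at hl
    have hl2 : μ i ≤ (1 - γ) * (μ i * μ i) + γ := by nlinarith
    have hsub := sum_weight_sq_sub hs (fun x => e i x / √(d x))
    rw [hq] at hsub
    change _ = 2 * (∑ x, d x * (e i x / √(d x)) ^ 2) - 2 * μ i at hsub
    have hterm : ∀ x y, 0 ≤ w x y * (e i x / √(d x) - e i y / √(d y)) ^ 2 := fun x y =>
      mul_nonneg (hn x y) (sq_nonneg _)
    have hpos : 0 ≤ ∑ x, ∑ y, w x y * (e i x / √(d x) - e i y / √(d y)) ^ 2 :=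
      Finset.sum_nonneg fun x _ => Finset.sum_nonneg fun y _ => hterm x y
    -- `hl2` reads `(μ - 1)((1 - γ)μ - γ) ≥ 0`, so an eigenvalue below `1` is at most `γ/(1-γ)`.
    rcases lt_or_ge (μ i) 1 with h1 | h1
    · left
      rw [le_div_iff₀ (by linarith)]
      nlinarith
    · right
      -- The Dirichlet energy is at most `2 - 2μ`, so it vanishes. Connectedness then makes the
      -- rescaled eigenvector constant off isolated vertices, hence the eigenvector is orthogonal to
      -- `√d · h`.
      have hz : ∑ x, ∑ y, w x y * (e i x / √(d x) - e i y / √(d y)) ^ 2 = 0 := by linarith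
      obtain ⟨c, hc⟩ := hconn (fun x => e i x / √(d x)) (by
        intro x y hxy
        have hx := (Finset.sum_eq_zero_iff_of_nonneg fun x _ =>
          Finset.sum_nonneg fun y _ => hterm x y).mp hz x (Finset.mem_univ x)
        have hy := (Finset.sum_eq_zero_iff_of_nonneg fun y _ => hterm x y).mp hx y
          (Finset.mem_univ y)
        rcases mul_eq_zero.mp hy with h' | h'
        · exact absurd h' hxy.ne'
        · exact sub_eq_zero.mp (pow_eq_zero_iff two_ne_zero |>.mp h'))
      have : e i ⬝ᵥ (fun x => √(d x) * h x) = c * ∑ x, d x * h x := by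
        rw [Finset.mul_sum]
        refine Finset.sum_congr rfl fun x _ => ?_
        by_cases hx : √(d x) = 0
        · have : d x = 0 := by rw [← hsq, hx]; simp
          simp [this]
        · have hpx : 0 < d x := by
            rw [← hsq]; positivity
          have := hc x hpx
          rw [div_eq_iff hx] at this
          rw [this]
          linear_combination c * h x * hsq x
      rw [this]
      exact mul_eq_zero_of_right _ hmean
  have hfin : ∑ x, ∑ y, w x y * h x * h y
      = (fun x => √(d x) * h x) ⬝ᵥ S *ᵥ (fun x => √(d x) * h x) := by
    rw [← hquad]
    refine Finset.sum_congr rfl fun x _ => Finset.sum_congr rfl fun y _ => ?_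
    by_cases hx : √(d x) = 0
    · simp [hwz x y hx]
    by_cases hy : √(d y) = 0
    · simp [hs x y, hwz y x hy]
    rw [mul_div_cancel_left₀ _ hx, mul_div_cancel_left₀ _ hy]
  have hfin2 : ∑ x, d x * h x ^ 2
      = (fun x => √(d x) * h x) ⬝ᵥ (fun x => √(d x) * h x) := by
    refine Finset.sum_congr rfl fun x _ => ?_
    linear_combination (-(h x) ^ 2) * hsq x
  rw [hfin, hfin2, dotProduct_mulVec_eq_sum hS hev hpars, hpars, Finset.mul_sum]
  refine Finset.sum_le_sum fun i _ => ?_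
  rcases hμ i with h1 | h1
  · rw [← pow_two]
    exact mul_le_mul_of_nonneg_right h1 (sq_nonneg _)
  · simp [h1]

/-- Contraction of variance when passing from the edges to the vertices of a weighted graph. -/
theorem SecondEigenvalueLE.variance_contraction {w φ : V → V → ℝ} {γ : ℝ}
    (hs : ∀ x y, w x y = w y x) (hn : ∀ x y, 0 ≤ w x y) (hφs : ∀ x y, φ x y = φ y x)
    (hφ : ∀ x y, w x y = 0 → φ x y = 0) (hγ0 : 0 ≤ γ) (h : SecondEigenvalueLE w γ) :
    ∑ x, (∑ y, φ x y) ^ 2 / (∑ y, w x y) - (∑ x, ∑ y, φ x y) ^ 2 / (∑ x, ∑ y, w x y) ≤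
      (1 + γ) / 2 * (∑ x, ∑ y, φ x y ^ 2 / w x y
        - (∑ x, ∑ y, φ x y) ^ 2 / (∑ x, ∑ y, w x y)) := by
  set D := ∑ x, ∑ y, w x y with hD
  set T := ∑ x, ∑ y, φ x y with hT
  set d : V → ℝ := fun x => ∑ y, w x y with hd
  set Φ : V → ℝ := fun x => ∑ y, φ x y with hΦ
  have hdz : ∀ x, d x = 0 → Φ x = 0 := fun x hx =>
    Finset.sum_eq_zero fun y _ => hφ x y (weight_eq_zero_of_degree hn hx y)
  have hDz : D = 0 → T = 0 := fun h0 => Finset.sum_eq_zero fun x _ => hdz x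
    ((Finset.sum_eq_zero_iff_of_nonneg fun x _ => Finset.sum_nonneg fun y _ => hn x y).mp h0 x
      (Finset.mem_univ x))
  set κ := T / D with hκ
  have hκD : κ * D = T := by
    by_cases h0 : D = 0
    · simp [h0, hDz h0]
    · rw [hκ]; field_simp
  have hκT : T ^ 2 / D = κ * T := by rw [hκ]; ring
  have hκ2 : κ ^ 2 * D = κ * T := by rw [pow_two, mul_assoc, hκD]
  -- The centred conditional mean of the edge function `φ / w` at an endpoint.
  set g : V → ℝ := fun x => Φ x / d x - κ with hg
  have hdΦ : ∀ x, d x * (Φ x / d x) = Φ x := fun x => by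
    by_cases h0 : d x = 0
    · simp [h0, hdz x h0]
    · field_simp
  have hdg : ∀ x, d x * g x = Φ x - κ * d x := fun x => by
    rw [hg]; linear_combination hdΦ x
  have hmean : ∑ x, d x * g x = 0 := by
    simp only [hdg, Finset.sum_sub_distrib, ← Finset.mul_sum]
    change T - κ * D = 0
    linarith
  have hA : ∑ x, d x * g x ^ 2 = ∑ x, Φ x ^ 2 / d x - T ^ 2 / D := by
    have : ∀ x, d x * g x ^ 2 = Φ x ^ 2 / d x - 2 * κ * Φ x + κ ^ 2 * d x := fun x => by
      rw [hg]
      linear_combination (Φ x / d x - 2 * κ) * hdΦ x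
    simp only [this, Finset.sum_sub_distrib, Finset.sum_add_distrib, ← Finset.mul_sum]
    change _ - 2 * κ * T + κ ^ 2 * D = _
    rw [hκT, hκ2]; ring
  have hψ : ∀ x y, (φ x y - κ * w x y) ^ 2 / w x y
      = φ x y ^ 2 / w x y - 2 * κ * φ x y + κ ^ 2 * w x y := fun x y => by
    by_cases h0 : w x y = 0
    · simp [h0, hφ x y h0]
    · field_simp
      ring
  have hB : ∑ x, ∑ y, (φ x y - κ * w x y) ^ 2 / w x y
      = ∑ x, ∑ y, φ x y ^ 2 / w x y - T ^ 2 / D := by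
    simp only [hψ, Finset.sum_sub_distrib, Finset.sum_add_distrib, ← Finset.mul_sum]
    rw [← hT, ← hD, hκT, hκ2]; ring
  have hsψ : ∀ x y, φ x y - κ * w x y = φ y x - κ * w y x := fun x y => by rw [hφs, hs]
  have hC : ∑ x, ∑ y, (φ x y - κ * w x y) * (g x + g y) = 2 * ∑ x, d x * g x ^ 2 := by
    have e1 := sum_symm_weight hsψ g
    have e2 : ∀ x, (∑ y, (φ x y - κ * w x y)) = d x * g x := fun x => by
      rw [hdg, Finset.sum_sub_distrib, ← Finset.mul_sum]
    simp only [mul_add, Finset.sum_add_distrib, e1, ← Finset.sum_mul, e2]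
    rw [← two_mul]
    congr 1
    exact Finset.sum_congr rfl fun x _ => by ring
  have hE := sum_weight_sq_add hs g
  have hQ := h g hmean
  change _ ≤ γ * ∑ x, d x * g x ^ 2 at hQ
  change _ = 2 * (∑ x, d x * g x ^ 2) + _ at hE
  set c := (1 + γ) / 2 with hc
  have hc0 : 0 < c := by rw [hc]; linarith
  -- Cauchy–Schwarz between `φ - κw` and `w (g x + g y)`, linearised by completing a square. The
  -- multiplier `c⁻¹` is chosen so that the total comes out as `c⁻¹ * A`.
  have hterm : ∀ x y, c⁻¹ * ((φ x y - κ * w x y) * (g x + g y))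
      - c⁻¹ ^ 2 / 4 * (w x y * (g x + g y) ^ 2) ≤ (φ x y - κ * w x y) ^ 2 / w x y := by
    intro x y
    by_cases h0 : w x y = 0
    · simp [h0, hφ x y h0]
    · have hw : 0 < w x y := lt_of_le_of_ne (hn x y) (Ne.symm h0)
      rw [le_div_iff₀ hw]
      nlinarith [sq_nonneg ((φ x y - κ * w x y) - c⁻¹ / 2 * w x y * (g x + g y))]
  have hsum := Finset.sum_le_sum fun x (_ : x ∈ Finset.univ) =>
    Finset.sum_le_sum fun y (_ : y ∈ Finset.univ) => hterm x y
  simp only [Finset.sum_sub_distrib, ← Finset.mul_sum] at hsum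
  rw [hC, hE] at hsum
  rw [← hA, ← hB]
  set A := ∑ x, d x * g x ^ 2
  have hkey : c⁻¹ ^ 2 / 4 * (2 * A + 2 * ∑ x, ∑ y, w x y * g x * g y) ≤ c⁻¹ * A := by
    calc _ ≤ c⁻¹ ^ 2 / 4 * (2 * A + 2 * (γ * A)) := by gcongr
      _ = c⁻¹ * (c⁻¹ * c) * A := by rw [hc]; ring
      _ = _ := by rw [inv_mul_cancel₀ hc0.ne', mul_one]
  have : c⁻¹ * A ≤ ∑ x, ∑ y, (φ x y - κ * w x y) ^ 2 / w x y := by linarith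
  rwa [inv_mul_le_iff₀ hc0] at this

end WeightedGraph

/-! ### Links of a uniform family of `k`-sets. -/

section UniformFamily

variable {V : Type*} [Fintype V] [DecidableEq V]

/-- The sum of `f` over the members of `T` containing `α`. -/
def upSum (T : Finset (Finset V)) (f : Finset V → ℝ) (α : Finset V) : ℝ :=
  ∑ τ ∈ T with α ⊆ τ, f τ

/-- The function induced by `upSum` on the ordered edges of the link of `α`. -/
def pairSum (T : Finset (Finset V)) (f : Finset V → ℝ) (α : Finset V) (x y : V) : ℝ :=
  if x ≠ y ∧ x ∉ α ∧ y ∉ α then upSum T f (insert x (insert y α)) else 0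

/-- The square of the mean of `f` over the members of `T` containing `α`, times the number of
these members. -/
noncomputable def sqRatio (T : Finset (Finset V)) (f : Finset V → ℝ) (α : Finset V) : ℝ :=
  upSum T f α ^ 2 / upSum T 1 α

/-- The second moment of the conditional means of `f` given a random subset of size `m` of a
random member of `T`, up to the factor `|T|`. -/
noncomputable def levelMoment (T : Finset (Finset V)) (f : Finset V → ℝ) (k m : ℕ) : ℝ :=
  (∑ α ∈ Finset.powersetCard m Finset.univ, sqRatio T f α) / (k.choose m : ℝ)

variable {T : Finset (Finset V)} {k : ℕ}

omit [Fintype V] in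
theorem upSum_one_nonneg (α : Finset V) : 0 ≤ upSum T 1 α :=
  Finset.sum_nonneg fun _ _ => zero_le_one

omit [Fintype V] in
theorem upSum_eq_zero (f : Finset V → ℝ) {α : Finset V} (h : upSum T 1 α = 0) :
    upSum T f α = 0 := by
  have : (T.filter fun τ => α ⊆ τ) = ∅ := by simpa [upSum] using h
  rw [upSum, this, Finset.sum_empty]

omit [Fintype V] in
theorem pairSum_symm (f : Finset V → ℝ) (α : Finset V) (x y : V) :
    pairSum T f α x y = pairSum T f α y x := by
  unfold pairSum
  rw [Finset.insert_comm]
  exact if_congr (by tauto) rfl rfl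

omit [Fintype V] in
theorem pairSum_one_nonneg (α : Finset V) (x y : V) : 0 ≤ pairSum T 1 α x y := by
  unfold pairSum
  split_ifs
  · exact upSum_one_nonneg _
  · exact le_rfl

omit [Fintype V] in
theorem pairSum_eq_zero (f : Finset V → ℝ) {α : Finset V} {x y : V}
    (h : pairSum T 1 α x y = 0) : pairSum T f α x y = 0 := by
  unfold pairSum at h ⊢
  split_ifs with hc
  · rw [if_pos hc] at h
    exact upSum_eq_zero f h
  · rfl

/-- Double counting: a `k`-set containing `α` has `k - |α|` elements outside `α`. -/
theorem sum_upSum_insert (hT : ∀ τ ∈ T, τ.card = k) (f : Finset V → ℝ) (α : Finset V) :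
    ∑ x ∈ αᶜ, upSum T f (insert x α) = ((k : ℝ) - α.card) * upSum T f α := by
  simp only [upSum, Finset.sum_filter, Finset.mul_sum]
  rw [Finset.sum_comm]
  refine Finset.sum_congr rfl fun τ hτ => ?_
  by_cases h : α ⊆ τ
  · have h1 : ∀ x, insert x α ⊆ τ ↔ x ∈ τ := fun x => by simp [Finset.insert_subset_iff, h]
    have h2 : (αᶜ.filter fun x => x ∈ τ) = τ \ α := by
      ext x; simp [and_comm]
    simp only [h1, h, if_true]
    rw [← Finset.sum_filter, h2, Finset.sum_const, nsmul_eq_mul, Finset.card_sdiff_of_subset h,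
      Nat.cast_sub (Finset.card_le_card h), hT τ hτ]
  · have h1 : ∀ x, ¬ insert x α ⊆ τ := fun x hx => h ((Finset.subset_insert x α).trans hx)
    simp [h1, h]

theorem sum_pair_ite (H : Finset V → ℝ) (α : Finset V) (x : V) :
    ∑ y, (if x ≠ y ∧ x ∉ α ∧ y ∉ α then H (insert x (insert y α)) else 0)
      = if x ∉ α then ∑ y ∈ (insert x α)ᶜ, H (insert y (insert x α)) else 0 := by
  by_cases hx : x ∈ α
  · simp [hx]
  · simp only [hx, not_false_eq_true, if_true, true_and]
    rw [← Finset.sum_filter]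
    refine Finset.sum_congr ?_ fun y _ => by rw [Finset.insert_comm]
    ext y
    simp [eq_comm]

theorem sum_ite_notMem (H : V → ℝ) (α : Finset V) :
    ∑ x, (if x ∉ α then H x else 0) = ∑ x ∈ αᶜ, H x := by
  rw [← Finset.sum_filter]
  exact Finset.sum_congr (by ext; simp) fun _ _ => rfl

theorem sum_pairSum (hT : ∀ τ ∈ T, τ.card = k) (f : Finset V → ℝ) (α : Finset V) (x : V) :
    ∑ y, pairSum T f α x y
      = if x ∉ α then ((k : ℝ) - α.card - 1) * upSum T f (insert x α) else 0 := by
  unfold pairSum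
  rw [sum_pair_ite (upSum T f)]
  split_ifs with hx
  · rfl
  · rw [sum_upSum_insert hT, Finset.card_insert_of_notMem hx]
    push_cast
    ring

theorem sum_pairSum_insert (hT : ∀ τ ∈ T, τ.card = k) (f : Finset V → ℝ) (α : Finset V)
    (x y : V) :
    ∑ v ∈ αᶜ, pairSum T f (insert v α) x y = ((k : ℝ) - α.card - 2) * pairSum T f α x y := by
  by_cases h : x ≠ y ∧ x ∉ α ∧ y ∉ α
  · have h1 := sum_upSum_insert hT f (insert x (insert y α))
    rw [Finset.card_insert_of_notMem (by simp [h.1, h.2.1]), Finset.card_insert_of_notMem h.2.2]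
      at h1
    rw [pairSum, if_pos h]
    push_cast at h1
    rw [show (k : ℝ) - α.card - 2 = k - (α.card + 1 + 1) by ring, ← h1]
    unfold pairSum
    rw [← Finset.sum_filter_add_sum_filter_not αᶜ (fun v => v ≠ x ∧ v ≠ y)]
    rw [Finset.sum_congr rfl (g := fun v => upSum T f (insert v (insert x (insert y α)))),
      Finset.sum_eq_zero (s := Finset.filter _ _) (f := fun v => ite _ _ _), add_zero]
    · refine Finset.sum_congr ?_ fun _ _ => rfl
      ext v; simp; tauto
    · intro v hv
      rw [if_neg]
      simp only [Finset.mem_filter, not_and, not_not, ne_eq] at hv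
      intro hc
      simp only [Finset.mem_insert, not_or] at hc
      exact hc.2.2.1 (hv.2 fun hvx => hc.2.1.1 hvx.symm).symm
    · intro v hv
      simp only [Finset.mem_filter, Finset.mem_compl] at hv
      rw [if_pos]
      · congr 1; ext z; simp; tauto
      · simp only [Finset.mem_insert, not_or]
        exact ⟨h.1, ⟨hv.2.1.symm, h.2.1⟩, hv.2.2.symm, h.2.2⟩
  · have : ∀ v, pairSum T f (insert v α) x y = 0 := fun v => by
      rw [pairSum, if_neg]
      simp only [Finset.mem_insert, not_or]
      tauto
    simp only [this, Finset.sum_const_zero]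
    rw [pairSum, if_neg h, mul_zero]

/-- Compatibility between levels: degrees in the link of `insert v α` are proportional to the edge
weights at `v` in the link of `α`. This lets `trickle_down` use the bounds on the smaller links. -/
theorem sum_pairSum_link (hT : ∀ τ ∈ T, τ.card = k) (f : Finset V → ℝ) {α : Finset V} {v : V}
    (hv : v ∉ α) (x : V) :
    ∑ y, pairSum T f (insert v α) x y = ((k : ℝ) - α.card - 2) * pairSum T f α v x := by
  rw [sum_pairSum hT, Finset.card_insert_of_notMem hv, pairSum]
  simp only [Finset.mem_insert, not_or]
  by_cases hx : x ≠ v ∧ x ∉ α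
  · rw [if_pos hx, if_pos ⟨hx.1.symm, hv, hx.2⟩, Finset.insert_comm]
    push_cast; ring
  · rw [if_neg hx, if_neg, mul_zero]
    intro h
    exact hx ⟨h.1.symm, h.2.2⟩

/-- Garland's localisation: the form of the link of `α` is, up to a factor, the sum over `v` of the
forms of the links of `insert v α`. Applying the unconstrained bound to each summand yields the
local hypothesis of `trickle_down`. -/
theorem secondEigenvalueLE_pairSum_of_links (hT : ∀ τ ∈ T, τ.card = k) {α : Finset V} {γ : ℝ}
    (hα : α.card + 3 ≤ k) (hγ0 : 0 ≤ γ) (hγ1 : γ < 1)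
    (hconn : ∀ g : V → ℝ, (∀ x y, 0 < pairSum T 1 α x y → g x = g y) →
      ∃ c, ∀ x, 0 < ∑ y, pairSum T 1 α x y → g x = c)
    (hlink : ∀ v ∉ α, SecondEigenvalueLE (pairSum T 1 (insert v α)) γ) :
    SecondEigenvalueLE (pairSum T 1 α) (γ / (1 - γ)) := by
  refine trickle_down (pairSum_symm 1 α) (pairSum_one_nonneg α) hγ0 hγ1 hconn fun g => ?_
  have hkα : (α.card : ℝ) + 3 ≤ k := by exact_mod_cast hα
  obtain ⟨m, hm⟩ : ∃ m : ℝ, m = (k : ℝ) - α.card - 2 := ⟨_, rfl⟩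
  have hm0 : 0 < m := by linarith
  have hv : ∀ v ∈ αᶜ, ∑ x, ∑ y, pairSum T 1 (insert v α) x y * g x * g y ≤
      m * ((1 - γ) * ((∑ y, pairSum T 1 α v y * g y) ^ 2 / ∑ y, pairSum T 1 α v y)
        + γ * ∑ x, pairSum T 1 α v x * g x ^ 2) := by
    intro v hv
    have hv' : v ∉ α := by simpa using hv
    have := (hlink v hv').quadratic_le (pairSum_symm 1 _) (pairSum_one_nonneg _) g
    simp only [sum_pairSum_link hT 1 hv', ← hm, mul_assoc, ← Finset.mul_sum] at this
    refine le_of_le_of_eq (by simpa only [mul_assoc] using this) ?_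
    rw [mul_pow, pow_two m, mul_assoc, mul_div_mul_left _ _ hm0.ne', mul_div_assoc]
    ring
  have hsum := Finset.sum_le_sum hv
  rw [← Finset.mul_sum, Finset.sum_add_distrib, ← Finset.mul_sum, ← Finset.mul_sum] at hsum
  have hL : ∑ v ∈ αᶜ, ∑ x, ∑ y, pairSum T 1 (insert v α) x y * g x * g y
      = m * ∑ x, ∑ y, pairSum T 1 α x y * g x * g y := by
    rw [Finset.sum_comm, Finset.mul_sum]
    refine Finset.sum_congr rfl fun x _ => ?_
    rw [Finset.sum_comm, Finset.mul_sum]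
    refine Finset.sum_congr rfl fun y _ => ?_
    rw [← Finset.sum_mul, ← Finset.sum_mul, sum_pairSum_insert hT, hm]
    ring
  have hz : ∀ v ∉ αᶜ, ∀ x, pairSum T 1 α v x = 0 := fun v hv x => by
    rw [pairSum, if_neg]
    simp only [Finset.mem_compl, not_not] at hv
    tauto
  have h1 : ∑ v ∈ αᶜ, (∑ y, pairSum T 1 α v y * g y) ^ 2 / ∑ y, pairSum T 1 α v y
      = ∑ v, (∑ y, pairSum T 1 α v y * g y) ^ 2 / ∑ y, pairSum T 1 α v y :=
    Finset.sum_subset (Finset.subset_univ _) fun v _ hv => by simp [hz v hv]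
  have h2 : ∑ v ∈ αᶜ, ∑ x, pairSum T 1 α v x * g x ^ 2
      = ∑ x, (∑ y, pairSum T 1 α x y) * g x ^ 2 := by
    rw [← sum_symm_weight (pairSum_symm 1 α)]
    exact Finset.sum_subset (Finset.subset_univ _) fun v _ hv => by simp [hz v hv]
  rw [hL, h1, h2] at hsum
  exact le_of_mul_le_mul_left hsum hm0

/-! ### Moments of conditional means and their increments. -/

theorem sum_powersetCard_insert (H : Finset V → ℝ) (j : ℕ) :
    ∑ α ∈ Finset.powersetCard j Finset.univ, ∑ x ∈ αᶜ, H (insert x α)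
      = ((j : ℝ) + 1) * ∑ β ∈ Finset.powersetCard (j + 1) Finset.univ, H β := by
  have : ((j : ℝ) + 1) * ∑ β ∈ Finset.powersetCard (j + 1) Finset.univ, H β
      = ∑ β ∈ Finset.powersetCard (j + 1) (Finset.univ : Finset V), ∑ x ∈ β, H β := by
    rw [Finset.mul_sum]
    refine Finset.sum_congr rfl fun β hβ => ?_
    rw [Finset.sum_const, (Finset.mem_powersetCard.mp hβ).2, nsmul_eq_mul]
    push_cast; ring
  rw [this, Finset.sum_sigma', Finset.sum_sigma']
  refine Finset.sum_bij' (fun p _ => ⟨insert p.2 p.1, p.2⟩) (fun p _ => ⟨p.1.erase p.2, p.2⟩)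
    ?_ ?_ ?_ ?_ ?_
  · rintro ⟨α, x⟩ h
    simp only [Finset.mem_sigma, Finset.mem_powersetCard, Finset.subset_univ, true_and,
      Finset.mem_compl] at h ⊢
    exact ⟨by rw [Finset.card_insert_of_notMem h.2, h.1], Finset.mem_insert_self _ _⟩
  · rintro ⟨β, x⟩ h
    simp only [Finset.mem_sigma, Finset.mem_powersetCard, Finset.subset_univ, true_and,
      Finset.mem_compl] at h ⊢
    exact ⟨by rw [Finset.card_erase_of_mem h.2, h.1]; rfl, Finset.notMem_erase _ _⟩
  · rintro ⟨α, x⟩ h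
    simp only [Finset.mem_sigma, Finset.mem_compl] at h
    simp [Finset.erase_insert h.2]
  · rintro ⟨β, x⟩ h
    simp only [Finset.mem_sigma] at h
    simp [Finset.insert_erase h.2]
  · intros
    rfl

/-- Variance contraction in the link of each `j`-set `α`, applied to `pairSum T f α` and summed over
`α`. The binomial identities `hc1` and `hc2` match the normalisations of the three levels. -/
theorem levelMoment_step (hT : ∀ τ ∈ T, τ.card = k) (f : Finset V → ℝ) {j : ℕ} {γ : ℝ}
    (hj : j + 2 ≤ k) (hγ0 : 0 ≤ γ)
    (hgap : ∀ α : Finset V, α.card = j → SecondEigenvalueLE (pairSum T 1 α) γ) :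
    levelMoment T f k (j + 1) - levelMoment T f k j ≤
      (1 + γ) / 2 * (levelMoment T f k (j + 2) - levelMoment T f k j) := by
  have hjk : (j : ℝ) + 2 ≤ k := by exact_mod_cast hj
  obtain ⟨m, hm⟩ : ∃ m : ℝ, m = (k : ℝ) - j - 1 := ⟨_, rfl⟩
  have hm0 : 0 < m := by linarith
  have hpt : ∀ α ∈ Finset.powersetCard j (Finset.univ : Finset V),
      m * ∑ x ∈ αᶜ, sqRatio T f (insert x α) - m * (m + 1) * sqRatio T f α ≤
        (1 + γ) / 2 * (∑ x ∈ αᶜ, ∑ y ∈ (insert x α)ᶜ, sqRatio T f (insert y (insert x α))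
          - m * (m + 1) * sqRatio T f α) := by
    intro α hα
    have hc : α.card = j := (Finset.mem_powersetCard.mp hα).2
    have h := (hgap α hc).variance_contraction (pairSum_symm 1 α) (pairSum_one_nonneg α)
      (pairSum_symm f α) (fun x y => pairSum_eq_zero f) hγ0
    have hdeg : ∀ (f : Finset V → ℝ) x, ∑ y, pairSum T f α x y
        = if x ∉ α then m * upSum T f (insert x α) else 0 := fun f x => by
      rw [sum_pairSum hT, hc, hm]
    have htot : ∀ f : Finset V → ℝ, ∑ x, ∑ y, pairSum T f α x y
        = m * (m + 1) * upSum T f α := fun f => by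
      simp only [hdeg]
      rw [sum_ite_notMem (fun x => m * upSum T f (insert x α)), ← Finset.mul_sum,
        sum_upSum_insert hT, hc, hm]
      ring
    have hq : ∀ c a b : ℝ, (c * a) ^ 2 / (c * b) = c * (a ^ 2 / b) := fun c a b => by
      by_cases hc : c = 0
      · simp [hc]
      rw [mul_pow, pow_two c, mul_assoc, mul_div_mul_left _ _ hc, mul_div_assoc]
    have h1 : ∑ x, (∑ y, pairSum T f α x y) ^ 2 / ∑ y, pairSum T 1 α x y
        = m * ∑ x ∈ αᶜ, sqRatio T f (insert x α) := by
      rw [Finset.mul_sum, ← sum_ite_notMem]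
      refine Finset.sum_congr rfl fun x _ => ?_
      simp only [hdeg]
      split_ifs
      · simp
      · exact hq _ _ _
    have h2 : ∑ x, ∑ y, pairSum T f α x y ^ 2 / pairSum T 1 α x y
        = ∑ x ∈ αᶜ, ∑ y ∈ (insert x α)ᶜ, sqRatio T f (insert y (insert x α)) := by
      rw [← sum_ite_notMem]
      refine Finset.sum_congr rfl fun x _ => ?_
      rw [← sum_pair_ite]
      refine Finset.sum_congr rfl fun y _ => ?_
      unfold pairSum
      split_ifs
      · rfl
      · simp
    rw [h1, h2, htot, htot, hq] at h
    exact h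
  have hsum := Finset.sum_le_sum hpt
  rw [Finset.sum_sub_distrib, ← Finset.mul_sum, ← Finset.mul_sum, ← Finset.mul_sum,
    Finset.sum_sub_distrib, ← Finset.mul_sum, sum_powersetCard_insert,
    sum_powersetCard_insert (fun β => ∑ y ∈ βᶜ, sqRatio T f (insert y β)),
    sum_powersetCard_insert] at hsum
  have hc1 : ((k.choose (j + 1) : ℕ) : ℝ) * (j + 1) = k.choose j * (m + 1) := by
    have := Nat.choose_succ_right_eq k j
    have h' : ((k.choose (j + 1) * (j + 1) : ℕ) : ℝ) = ((k.choose j * (k - j) : ℕ) : ℝ) := by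
      rw [this]
    rw [Nat.cast_mul, Nat.cast_mul, Nat.cast_sub (by omega)] at h'
    push_cast at h'
    rw [h', hm]; ring
  have hc2 : ((k.choose (j + 2) : ℕ) : ℝ) * (j + 2) = k.choose (j + 1) * m := by
    have := Nat.choose_succ_right_eq k (j + 1)
    have h' : ((k.choose (j + 2) * (j + 2) : ℕ) : ℝ)
        = ((k.choose (j + 1) * (k - (j + 1)) : ℕ) : ℝ) := by
      rw [← this]
    rw [Nat.cast_mul, Nat.cast_mul, Nat.cast_sub (by omega)] at h'
    push_cast at h'
    rw [h', hm]; ring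
  have hp0 : (0 : ℝ) < k.choose j := by exact_mod_cast Nat.choose_pos (by omega)
  have hp1 : (0 : ℝ) < k.choose (j + 1) := by exact_mod_cast Nat.choose_pos (by omega)
  have hp2 : (0 : ℝ) < k.choose (j + 2) := by exact_mod_cast Nat.choose_pos (by omega)
  have key : ∀ (l : ℕ) , (0 : ℝ) < k.choose l →
      ∑ β ∈ Finset.powersetCard l Finset.univ, sqRatio T f β
        = k.choose l * levelMoment T f k l := fun l hl => by
    rw [levelMoment]; field_simp
  rw [key _ hp0, key _ hp1, key _ hp2] at hsum
  refine le_of_mul_le_mul_left ?_ (mul_pos (mul_pos hm0 (by linarith : 0 < m + 1)) hp0)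
  push_cast at hsum
  have e1 : m * ((j + 1) * (k.choose (j + 1) * levelMoment T f k (j + 1)))
      = m * (m + 1) * k.choose j * levelMoment T f k (j + 1) := by
    linear_combination m * levelMoment T f k (j + 1) * hc1
  have e2 : ((j : ℝ) + 1) * ((j + 1 + 1) * (k.choose (j + 2) * levelMoment T f k (j + 2)))
      = m * (m + 1) * k.choose j * levelMoment T f k (j + 2) := by
    linear_combination (j + 1 : ℝ) * levelMoment T f k (j + 2) * hc2
      + m * levelMoment T f k (j + 2) * hc1
  rw [e1, e2] at hsum
  linarith

theorem levelMoment_gap (hT : ∀ τ ∈ T, τ.card = k) (hk : 1 ≤ k) (f : Finset V → ℝ)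
    (hgap : ∀ α : Finset V, α.card + 2 ≤ k →
      SecondEigenvalueLE (pairSum T 1 α) (1 / ((α.card : ℝ) + 2))) :
    levelMoment T f k k - levelMoment T f k 0 ≤
      (k : ℝ) ^ 2 * (levelMoment T f k k - levelMoment T f k (k - 1)) := by
  suffices h : ∀ m : ℕ, m + 1 ≤ k → levelMoment T f k (m + 1) - levelMoment T f k 0 ≤
      ((m : ℝ) + 1) ^ 2 * (levelMoment T f k (m + 1) - levelMoment T f k m) by
    obtain ⟨m, rfl⟩ : ∃ m, k = m + 1 := ⟨k - 1, by omega⟩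
    have := h m le_rfl
    push_cast
    exact this
  intro m
  induction m with
  | zero => intro _; simp
  | succ m ih =>
    intro hm
    have h1 := ih (by omega)
    have h2 := levelMoment_step hT f (j := m) (γ := 1 / ((m : ℝ) + 2)) (by omega) (by positivity)
      (fun α hα => by
        have := hgap α (by omega)
        rwa [hα] at this)
    have h3 : (1 + 1 / ((m : ℝ) + 2)) / 2 = (m + 3) / (2 * (m + 2)) := by field_simp; ring
    rw [h3, div_mul_eq_mul_div, le_div_iff₀ (by positivity)] at h2
    push_cast
    change levelMoment T f k (m + 2) - _ ≤ _ * (levelMoment T f k (m + 2) - _)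
    -- With `a = M_{m+1} - M_m` and `b = M_{m+2} - M_{m+1}`, `h2` amounts to `(m+1)a ≤ (m+3)b`.
    -- Together with `ih` this closes the induction because `(m+1)(m+3) + 1 = (m+2)²`.
    have h4 := mul_le_mul_of_nonneg_left h2 (by positivity : (0 : ℝ) ≤ m + 1)
    nlinarith

end UniformFamily

/-! ### Links in the complex of independent sets. -/

section Graph

variable {V : Type*} [Fintype V] [DecidableEq V]

open scoped Matrix

/-- The independent sets of size exactly `k`. -/
noncomputable def indepSets (G : SimpleGraph V) (k : ℕ) : Finset (Finset V) :=
  (HDX.independentSetComplex G k).facesOfCard k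

theorem mem_faces_independentSetComplex {G : SimpleGraph V} {k : ℕ} {α : Finset V} :
    α ∈ (HDX.independentSetComplex G k).faces ↔ G.IsIndepSet (α : Set V) ∧ α.card ≤ k := by
  simp [HDX.independentSetComplex]

theorem mem_facesOfCard_independentSetComplex {G : SimpleGraph V} {k m : ℕ} (hm : m ≤ k)
    {α : Finset V} : α ∈ (HDX.independentSetComplex G k).facesOfCard m ↔
      G.IsIndepSet (α : Set V) ∧ α.card = m := by
  simp only [HDX.Complex.facesOfCard, Finset.mem_filter, mem_faces_independentSetComplex]
  constructor
  · exact fun h => ⟨h.1.1, h.2⟩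
  · exact fun h => ⟨⟨h.1, h.2.trans_le hm⟩, h.2⟩

theorem mem_indepSets {G : SimpleGraph V} {k : ℕ} {α : Finset V} :
    α ∈ indepSets G k ↔ G.IsIndepSet (α : Set V) ∧ α.card = k :=
  mem_facesOfCard_independentSetComplex le_rfl

theorem card_of_mem_indepSets (G : SimpleGraph V) (k : ℕ) : ∀ τ ∈ indepSets G k, τ.card = k :=
  fun _ h => (mem_indepSets.mp h).2

variable (G : SimpleGraph V) [DecidableRel G.Adj]

/-- The closed neighbourhood of a set of vertices. -/
def closedNeighbors (α : Finset V) : Finset V :=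
  α.biUnion fun v => insert v (G.neighborFinset v)

theorem card_closedNeighbors_le (α : Finset V) :
    (closedNeighbors G α).card ≤ α.card * (G.maxDegree + 1) := by
  refine Finset.card_biUnion_le_card_mul _ _ _ fun v _ => ?_
  refine (Finset.card_insert_le _ _).trans ?_
  rw [G.card_neighborFinset_eq_degree]
  exact Nat.succ_le_succ (G.degree_le_maxDegree v)

variable {G}

theorem notMem_closedNeighbors {α : Finset V} {x : V} :
    x ∉ closedNeighbors G α ↔ x ∉ α ∧ ∀ v ∈ α, ¬ G.Adj x v := by
  simp only [closedNeighbors, Finset.mem_biUnion, Finset.mem_insert, SimpleGraph.mem_neighborFinset,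
    not_exists, not_and, not_or]
  constructor
  · exact fun h => ⟨fun hx => (h x hx).1 rfl, fun v hv hxv => (h v hv).2 hxv.symm⟩
  · rintro ⟨h1, h2⟩ v hv
    exact ⟨fun hxv => h1 (hxv ▸ hv), fun hxv => h2 v hv hxv.symm⟩

theorem isIndepSet_insert_iff {α : Finset V} {x : V} (hx : x ∉ α) :
    G.IsIndepSet ((insert x α : Finset V) : Set V) ↔
      G.IsIndepSet (α : Set V) ∧ x ∉ closedNeighbors G α := by
  have : Std.Symm (fun v w : V => ¬ G.Adj v w) := ⟨fun a b h h' => h h'.symm⟩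
  rw [notMem_closedNeighbors, Finset.coe_insert, SimpleGraph.IsIndepSet,
    Set.pairwise_insert_of_symm]
  refine and_congr_right fun _ => ⟨fun h => ⟨hx, fun v hv => h v hv ?_⟩, fun h v hv _ => h.2 v hv⟩
  rintro rfl
  exact hx hv

theorem pair_isIndepSet_iff {α : Finset V} (hα : G.IsIndepSet (α : Set V)) {x y : V} :
    (x ≠ y ∧ x ∉ α ∧ y ∉ α) ∧ G.IsIndepSet ((insert x (insert y α) : Finset V) : Set V) ↔
      x ≠ y ∧ x ∉ closedNeighbors G α ∧ y ∉ closedNeighbors G α ∧ ¬ G.Adj x y := by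
  constructor
  · rintro ⟨⟨hxy, hx, hy⟩, h⟩
    rw [isIndepSet_insert_iff (by simp [hxy, hx]), isIndepSet_insert_iff hy,
      notMem_closedNeighbors (x := x)] at h
    exact ⟨hxy, notMem_closedNeighbors.mpr ⟨hx, fun v hv => h.2.2 v (Finset.mem_insert_of_mem hv)⟩,
      h.1.2, h.2.2 y (Finset.mem_insert_self _ _)⟩
  · rintro ⟨hxy, hx, hy, hadj⟩
    have hx' := notMem_closedNeighbors.mp hx
    have hy' := notMem_closedNeighbors.mp hy
    refine ⟨⟨hxy, hx'.1, hy'.1⟩, ?_⟩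
    rw [isIndepSet_insert_iff (by simp [hxy, hx'.1]), isIndepSet_insert_iff hy'.1,
      notMem_closedNeighbors (x := x)]
    refine ⟨⟨hα, hy⟩, by simp [hxy, hx'.1], fun v hv => ?_⟩
    rcases Finset.mem_insert.mp hv with rfl | hv
    · exact hadj
    · exact hx'.2 v hv

/-- Greedy extension: fewer than `k` closed neighbourhoods, each of size at most `Δ + 1`, cannot
cover `V`. -/
theorem exists_insert_isIndepSet {k : ℕ} (hk : k * (G.maxDegree + 1) ≤ Fintype.card V)
    {α : Finset V} (hα : G.IsIndepSet (α : Set V)) (hc : α.card < k) :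
    ∃ x ∉ α, G.IsIndepSet ((insert x α : Finset V) : Set V) := by
  have hlt : (closedNeighbors G α).card < Fintype.card V := by
    have h1 := card_closedNeighbors_le G α
    have h2 : α.card * (G.maxDegree + 1) < k * (G.maxDegree + 1) :=
      Nat.mul_lt_mul_of_pos_right hc (Nat.succ_pos _)
    omega
  obtain ⟨x, hx⟩ : ∃ x, x ∉ closedNeighbors G α := by
    by_contra! h
    rw [Finset.eq_univ_of_forall h, Finset.card_univ] at hlt
    exact lt_irrefl _ hlt
  have hx' := (notMem_closedNeighbors.mp hx).1
  exact ⟨x, hx', (isIndepSet_insert_iff hx').mpr ⟨hα, hx⟩⟩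

theorem exists_indepSets_superset {k : ℕ} (hk : k * (G.maxDegree + 1) ≤ Fintype.card V)
    {α : Finset V} (hα : G.IsIndepSet (α : Set V)) (hc : α.card ≤ k) :
    ∃ τ ∈ indepSets G k, α ⊆ τ := by
  obtain ⟨t, ht⟩ := Nat.exists_eq_add_of_le hc
  induction t generalizing α with
  | zero => exact ⟨α, mem_indepSets.mpr ⟨hα, ht.symm⟩, subset_rfl⟩
  | succ t ih =>
    obtain ⟨x, hx, hi⟩ := exists_insert_isIndepSet hk hα (by omega)
    have hcard := Finset.card_insert_of_notMem hx
    obtain ⟨τ, hτ, hs⟩ := ih hi (by omega) (by omega)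
    exact ⟨τ, hτ, (Finset.subset_insert x α).trans hs⟩

theorem upSum_indepSets_pos_iff {k : ℕ} (hk : k * (G.maxDegree + 1) ≤ Fintype.card V)
    {α : Finset V} (hc : α.card ≤ k) :
    0 < upSum (indepSets G k) 1 α ↔ G.IsIndepSet (α : Set V) := by
  have : upSum (indepSets G k) 1 α = ((indepSets G k).filter fun τ => α ⊆ τ).card := by
    simp [upSum]
  rw [this, Nat.cast_pos, Finset.card_pos]
  constructor
  · rintro ⟨τ, hτ⟩
    rw [Finset.mem_filter, mem_indepSets] at hτ
    exact hτ.1.1.mono (by exact_mod_cast hτ.2)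
  · intro h
    obtain ⟨τ, hτ, hs⟩ := exists_indepSets_superset hk h hc
    exact ⟨τ, Finset.mem_filter.mpr ⟨hτ, hs⟩⟩

theorem pairSum_indepSets_pos_iff {k : ℕ} (hk : k * (G.maxDegree + 1) ≤ Fintype.card V)
    {α : Finset V} (hα : G.IsIndepSet (α : Set V)) (hc : α.card + 2 ≤ k) {x y : V} :
    0 < pairSum (indepSets G k) 1 α x y ↔
      x ≠ y ∧ x ∉ closedNeighbors G α ∧ y ∉ closedNeighbors G α ∧ ¬ G.Adj x y := by
  rw [← pair_isIndepSet_iff hα]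
  unfold pairSum
  split_ifs with h
  · have hcard : (insert x (insert y α)).card ≤ k := by
      have h1 := Finset.card_insert_le x (insert y α)
      have h2 := Finset.card_insert_le y α
      omega
    rw [upSum_indepSets_pos_iff hk hcard]
    exact ⟨fun h' => ⟨h, h'⟩, fun h' => h'.2⟩
  · simp [h]

omit [DecidableRel G.Adj] in
theorem pairSum_indepSets_of_not_isIndepSet (k : ℕ) {α : Finset V}
    (hα : ¬ G.IsIndepSet (α : Set V)) (x y : V) : pairSum (indepSets G k) 1 α x y = 0 := by
  unfold pairSum upSum
  split_ifs
  · refine Finset.sum_eq_zero fun τ hτ => ?_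
    rw [Finset.mem_filter, mem_indepSets] at hτ
    refine absurd (hτ.1.1.mono ?_) hα
    exact_mod_cast ((Finset.subset_insert _ _).trans (Finset.subset_insert _ _)).trans hτ.2
  · rfl

theorem link_connected {k : ℕ} (hk : k * (G.maxDegree + 1) ≤ Fintype.card V)
    {α : Finset V} (hα : G.IsIndepSet (α : Set V)) (hc : α.card + 2 ≤ k) (g : V → ℝ)
    (hg : ∀ x y, 0 < pairSum (indepSets G k) 1 α x y → g x = g y) :
    ∃ c, ∀ x, 0 < ∑ y, pairSum (indepSets G k) 1 α x y → g x = c := by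
  have hmem : ∀ x, 0 < ∑ y, pairSum (indepSets G k) 1 α x y → x ∉ closedNeighbors G α := by
    intro x hx
    obtain ⟨y, -, hy⟩ := Finset.exists_lt_of_sum_lt (s := Finset.univ) (f := fun _ : V => (0 : ℝ))
      (by simpa using hx)
    exact ((pairSum_indepSets_pos_iff hk hα hc).mp hy).2.1
  have hpair : ∀ x y, x ∉ closedNeighbors G α → y ∉ closedNeighbors G α → g x = g y := by
    intro x y hx hy
    by_cases hxy : x = y
    · rw [hxy]
    by_cases hadj : G.Adj x y
    -- Vertices adjacent in `G` are not joined in the link, but two spare units of `Δ + 1` leave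
    -- room for a common link neighbour `z`.
    · have hlt : (closedNeighbors G α ∪ (G.neighborFinset x ∪ G.neighborFinset y)).card
          < Fintype.card V := by
        have h1 := Finset.card_union_le (closedNeighbors G α)
          (G.neighborFinset x ∪ G.neighborFinset y)
        have h2 := Finset.card_union_le (G.neighborFinset x) (G.neighborFinset y)
        rw [G.card_neighborFinset_eq_degree, G.card_neighborFinset_eq_degree] at h2
        have h3 := G.degree_le_maxDegree x
        have h4 := G.degree_le_maxDegree y
        have h5 := card_closedNeighbors_le G α
        have h6 : (α.card + 2) * (G.maxDegree + 1) ≤ k * (G.maxDegree + 1) :=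
          Nat.mul_le_mul_right _ hc
        rw [add_mul] at h6
        omega
      obtain ⟨z, hz⟩ : ∃ z, z ∉ closedNeighbors G α ∪ (G.neighborFinset x ∪ G.neighborFinset y) := by
        by_contra! h
        rw [Finset.eq_univ_of_forall h, Finset.card_univ] at hlt
        exact lt_irrefl _ hlt
      simp only [Finset.mem_union, SimpleGraph.mem_neighborFinset, not_or] at hz
      rw [hg x z, hg y z]
      · refine (pairSum_indepSets_pos_iff hk hα hc).mpr ⟨?_, hy, hz.1, hz.2.2⟩
        rintro rfl
        exact hz.2.1 hadj
      · refine (pairSum_indepSets_pos_iff hk hα hc).mpr ⟨?_, hx, hz.1, hz.2.1⟩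
        rintro rfl
        exact hz.2.2 hadj.symm
    · exact hg x y ((pairSum_indepSets_pos_iff hk hα hc).mpr ⟨hxy, hx, hy, hadj⟩)
  by_cases hne : ∃ x, x ∉ closedNeighbors G α
  · obtain ⟨x₀, h₀⟩ := hne
    exact ⟨g x₀, fun x hx => hpair x x₀ (hmem x hx) h₀⟩
  · exact ⟨0, fun x hx => absurd ⟨x, hmem x hx⟩ hne⟩

theorem pairSum_indepSets_codim_two {k : ℕ} (hk : k * (G.maxDegree + 1) ≤ Fintype.card V)
    {α : Finset V} (hα : G.IsIndepSet (α : Set V)) (hc : α.card + 2 = k) (x y : V) :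
    pairSum (indepSets G k) 1 α x y =
      if x ≠ y ∧ x ∉ closedNeighbors G α ∧ y ∉ closedNeighbors G α ∧ ¬ G.Adj x y
        then 1 else 0 := by
  have hiff := pairSum_indepSets_pos_iff hk hα hc.le (x := x) (y := y)
  by_cases h : x ≠ y ∧ x ∉ closedNeighbors G α ∧ y ∉ closedNeighbors G α ∧ ¬ G.Adj x y
  · rw [if_pos h]
    obtain ⟨hne, hI⟩ := (pair_isIndepSet_iff hα).mpr h
    rw [pairSum, if_pos hne, upSum]
    have hcard : (insert x (insert y α)).card = k := by
      rw [Finset.card_insert_of_notMem (by simp [hne.1, hne.2.1]),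
        Finset.card_insert_of_notMem hne.2.2, ← hc]
    have : (indepSets G k).filter (fun τ => insert x (insert y α) ⊆ τ)
        = {insert x (insert y α)} := by
      ext τ
      simp only [Finset.mem_filter, Finset.mem_singleton, mem_indepSets]
      constructor
      · rintro ⟨h1, h2⟩
        exact (Finset.eq_of_subset_of_card_le h2 (by rw [hcard, h1.2])).symm
      · rintro rfl
        exact ⟨⟨hI, hcard⟩, subset_rfl⟩
    rw [this]
    simp
  · rw [if_neg h]
    rw [← hiff] at h
    exact le_antisymm (not_lt.mp h) (pairSum_one_nonneg _ _ _)

/-- Test vector `1_u - 1_v`: squared norm `2`, quadratic form `-2`. -/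
theorem one_le_abs_eigenvalueMin_adjMatrix {u v : V} (huv : G.Adj u v) :
    1 ≤ |HDX.eigenvalueMin (G.adjMatrix ℝ)| := by
  have h := eigenvalueMin_mul_le (G.adjMatrix ℝ) G.isSymm_adjMatrix
    (Pi.single u 1 - Pi.single v 1)
  have hne := huv.ne
  simp only [sub_dotProduct, dotProduct_sub, Matrix.mulVec_sub, single_one_dotProduct,
    Matrix.mulVec_single_one, Matrix.col_apply, SimpleGraph.adjMatrix_apply, huv, huv.symm,
    if_true, SimpleGraph.irrefl, if_false, Pi.single_eq_same, Pi.single_eq_of_ne hne,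
    Pi.single_eq_of_ne hne.symm] at h
  exact le_abs.mpr (Or.inr (by linarith))

theorem mul_maxDegree_add_one_le {k : ℕ} (hkV : k ≤ Fintype.card V)
    (hk : (k : ℝ) * ((G.maxDegree : ℝ) + |HDX.eigenvalueMin (G.adjMatrix ℝ)|)
      ≤ (Fintype.card V : ℝ)) : k * (G.maxDegree + 1) ≤ Fintype.card V := by
  by_cases h0 : G.maxDegree = 0
  · simpa [h0] using hkV
  · obtain ⟨u, v, huv⟩ : ∃ u v, G.Adj u v := by
      by_contra! h
      apply h0
      rw [← Nat.le_zero]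
      refine G.maxDegree_le_of_forall_degree_le 0 fun v => ?_
      rw [← G.card_neighborFinset_eq_degree, Nat.le_zero, Finset.card_eq_zero]
      ext w
      simp [h v w]
    have h1 := one_le_abs_eigenvalueMin_adjMatrix huv
    have : (k : ℝ) * (G.maxDegree + 1) ≤ Fintype.card V :=
      le_trans (by gcongr) hk
    exact_mod_cast this

/-! ### Local spectral bounds for independent sets. -/

theorem secondEigenvalueLE_codim_two {k : ℕ} (hkV : k ≤ Fintype.card V)
    (hk : (k : ℝ) * ((G.maxDegree : ℝ) + |HDX.eigenvalueMin (G.adjMatrix ℝ)|)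
      ≤ (Fintype.card V : ℝ)) {α : Finset V} (hα : G.IsIndepSet (α : Set V))
    (hc : α.card + 2 = k) :
    SecondEigenvalueLE (pairSum (indepSets G k) 1 α) (1 / ((α.card : ℝ) + 2)) := by
  have hkΔ := mul_maxDegree_add_one_le hkV hk
  intro g hg
  have hck : (α.card : ℝ) + 2 = k := by exact_mod_cast hc
  rw [hck]
  set L := |HDX.eigenvalueMin (G.adjMatrix ℝ)| with hL
  set C := closedNeighbors G α with hC
  set w := pairSum (indepSets G k) 1 α with hw
  have hk2 : (2 : ℝ) ≤ k := by rw [← hck]; linarith [(Nat.cast_nonneg α.card : (0 : ℝ) ≤ _)]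
  have hweq : ∀ x y, w x y = if x ≠ y ∧ x ∉ C ∧ y ∉ C ∧ ¬ G.Adj x y then 1 else 0 :=
    pairSum_indepSets_codim_two hkΔ hα hc
  -- The degree of `x` is at least `|V| - |C| - 1 - deg x`. With `|C| ≤ (k-2)(Δ+1)` and the
  -- hypothesis on `k` this is at least `k(L-1) + Δ + 1`.
  have hdeg : ∀ x ∉ C, (L - 1) ≤ 1 / k * ∑ y, w x y := by
    intro x hx
    have h1 : ∀ y, (1 : ℝ) - (if y ∈ C then 1 else 0) - (if x = y then 1 else 0)
        - G.adjMatrix ℝ x y ≤ w x y := by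
      intro y
      rw [hweq, SimpleGraph.adjMatrix_apply]
      by_cases h1 : x = y <;> by_cases h2 : y ∈ C <;> by_cases h3 : G.Adj x y <;>
        simp [h1, h2, h3, hx]
    have h2 := Finset.sum_le_sum fun y (_ : y ∈ Finset.univ) => h1 y
    have h3 : ∑ y, G.adjMatrix ℝ x y = G.degree x := by
      simp [SimpleGraph.adjMatrix_apply, ← G.card_neighborFinset_eq_degree,
        G.neighborFinset_eq_filter]
    simp only [Finset.sum_sub_distrib, h3] at h2
    simp only [Finset.sum_const, Finset.card_univ, nsmul_eq_mul, mul_one, Finset.sum_ite_mem,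
      Finset.univ_inter, Finset.sum_ite_eq, Finset.mem_univ, if_true] at h2
    have h4 : (C.card : ℝ) ≤ (k - 2) * (G.maxDegree + 1) := by
      have := card_closedNeighbors_le G α
      rw [← hck]
      have h' : (C.card : ℝ) ≤ α.card * (G.maxDegree + 1) := by exact_mod_cast this
      linarith
    have h5 : (G.degree x : ℝ) ≤ G.maxDegree := by exact_mod_cast G.degree_le_maxDegree x
    have h6 : (0 : ℝ) ≤ G.maxDegree := Nat.cast_nonneg _
    rw [one_div, inv_mul_eq_div, le_div_iff₀ (by linarith)]
    nlinarith
  have hdeg0 : ∀ x ∈ C, ∑ y, w x y = 0 := fun x hx =>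
    Finset.sum_eq_zero fun y _ => by rw [hweq, if_neg]; tauto
  have hquad : ∀ g : V → ℝ, ∑ x, ∑ y, w x y * g x * g y ≤
      (∑ x, if x ∈ C then 0 else g x) ^ 2 + (L - 1) * ∑ x, (if x ∈ C then 0 else g x) ^ 2 := by
    intro g
    set h : V → ℝ := fun x => if x ∈ C then 0 else g x with hh
    have h1 : ∀ x y, w x y * g x * g y
        = h x * h y - (if x = y then h x * h y else 0) - h x * (G.adjMatrix ℝ x y * h y) := by
      intro x y
      rw [hweq, SimpleGraph.adjMatrix_apply, hh]
      by_cases h1 : x = y <;> by_cases h2 : y ∈ C <;> by_cases h2 : x ∈ C <;>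
        by_cases h3 : G.Adj x y <;> simp_all
    have h2 : ∑ x, ∑ y, w x y * g x * g y
        = (∑ x, h x) ^ 2 - ∑ x, h x ^ 2 - h ⬝ᵥ G.adjMatrix ℝ *ᵥ h := by
      simp only [h1, Finset.sum_sub_distrib, Finset.sum_ite_eq, Finset.mem_univ, if_true,
        dotProduct, Matrix.mulVec, Finset.mul_sum, pow_two, Finset.sum_mul]
      rw [Finset.sum_comm (f := fun i j => h j * h i)]
    have h3 := eigenvalueMin_mul_le (G.adjMatrix ℝ) G.isSymm_adjMatrix h
    have h4 : h ⬝ᵥ h = ∑ x, h x ^ 2 := Finset.sum_congr rfl fun x _ => (pow_two _).symm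
    rw [h4] at h3
    have h5 : 0 ≤ ∑ x, h x ^ 2 := Finset.sum_nonneg fun x _ => sq_nonneg _
    have h6 : -L ≤ HDX.eigenvalueMin (G.adjMatrix ℝ) := neg_abs_le _
    rw [h2]
    nlinarith
  -- `g` has degree-weighted mean zero, whereas `hquad` favours unweighted mean zero off `C`; hence
  -- the shift by `c`. It adds `c²D` to the form and only `c²D/k` to the bound, so it can be undone
  -- (`e6`).
  obtain ⟨c, hcz⟩ : ∃ c : ℝ, ∑ x, (if x ∈ C then 0 else g x - c) = 0 := by
    simp only [Finset.sum_ite, Finset.sum_const_zero, zero_add,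
      Finset.sum_sub_distrib, Finset.sum_const, nsmul_eq_mul]
    by_cases hz : (Finset.univ.filter fun x => ¬ x ∈ C).card = 0
    · rw [Finset.card_eq_zero] at hz
      exact ⟨0, by simp [hz]⟩
    · exact ⟨(∑ x with ¬ x ∈ C, g x) / (Finset.univ.filter fun x => ¬ x ∈ C).card, by
        field_simp; simp⟩
  have hq := hquad (fun x => g x - c)
  simp only [hcz] at hq
  have hs : ∀ x y, w x y = w y x := pairSum_symm 1 α
  have hD0 : 0 ≤ ∑ x, ∑ y, w x y :=
    Finset.sum_nonneg fun x _ => Finset.sum_nonneg fun y _ => pairSum_one_nonneg _ _ _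
  set D := ∑ x, ∑ y, w x y with hD
  have e3 : ∑ x, ∑ y, w x y * (g x - c) * (g y - c)
      = ∑ x, ∑ y, w x y * g x * g y + c ^ 2 * D := by
    have e1 := sum_symm_weight hs g
    have e2 : ∑ x, ∑ y, w x y * g x = 0 := by rw [← hg]; simp only [Finset.sum_mul]
    have : ∀ x y, w x y * (g x - c) * (g y - c) = w x y * g x * g y
      - c * (w x y * g x) - c * (w x y * g y) + c ^ 2 * w x y := fun x y => by ring
    simp only [this, Finset.sum_sub_distrib, Finset.sum_add_distrib, ← Finset.mul_sum, ← hD, e1,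
      e2, hg]
    ring
  have e4 : ∑ x, (∑ y, w x y) * (g x - c) ^ 2
      = ∑ x, (∑ y, w x y) * g x ^ 2 + c ^ 2 * D := by
    have : ∀ x, (∑ y, w x y) * (g x - c) ^ 2 = (∑ y, w x y) * g x ^ 2
      - 2 * c * ((∑ y, w x y) * g x) + c ^ 2 * ∑ y, w x y := fun x => by ring
    simp only [this, Finset.sum_sub_distrib, Finset.sum_add_distrib, ← Finset.mul_sum, hg, ← hD]
    ring
  have e5 : (L - 1) * ∑ x, (if x ∈ C then 0 else g x - c) ^ 2
      ≤ 1 / k * ∑ x, (∑ y, w x y) * (g x - c) ^ 2 := by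
    rw [Finset.mul_sum, Finset.mul_sum]
    refine Finset.sum_le_sum fun x _ => ?_
    by_cases hx : x ∈ C
    · simp [hx, hdeg0 x hx]
    · rw [if_neg hx, ← mul_assoc]
      exact mul_le_mul_of_nonneg_right (hdeg x hx) (sq_nonneg _)
  rw [e4] at e5
  rw [e3] at hq
  have e6 : 1 / (k : ℝ) * (c ^ 2 * D) ≤ c ^ 2 * D := by
    refine mul_le_of_le_one_left (mul_nonneg (sq_nonneg _) hD0) ?_
    rw [div_le_one (by linarith)]
    linarith
  rw [mul_add] at e5
  linarith

theorem secondEigenvalueLE_indepSets {k : ℕ} (hkV : k ≤ Fintype.card V)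
    (hk : (k : ℝ) * ((G.maxDegree : ℝ) + |HDX.eigenvalueMin (G.adjMatrix ℝ)|)
      ≤ (Fintype.card V : ℝ)) {α : Finset V} (hc : α.card + 2 ≤ k) :
    SecondEigenvalueLE (pairSum (indepSets G k) 1 α) (1 / ((α.card : ℝ) + 2)) := by
  obtain ⟨t, ht⟩ := Nat.exists_eq_add_of_le hc
  -- Non-independent sets have zero link weights, so only independent ones need the induction on
  -- codimension.
  by_cases hα : G.IsIndepSet (α : Set V)
  swap
  · intro g _
    simp [pairSum_indepSets_of_not_isIndepSet k hα]
  induction t generalizing α with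
  | zero => exact secondEigenvalueLE_codim_two hkV hk hα ht.symm
  | succ t ih =>
    have h0 : (0 : ℝ) ≤ α.card := Nat.cast_nonneg _
    have h := secondEigenvalueLE_pairSum_of_links (card_of_mem_indepSets G k) (α := α)
      (γ := 1 / ((α.card : ℝ) + 3)) (by omega) (by positivity)
      (by rw [div_lt_one (by positivity)]; linarith)
      (link_connected (mul_maxDegree_add_one_le hkV hk) hα hc)
      (fun v hv => by
        by_cases hi : G.IsIndepSet ((insert v α : Finset V) : Set V)
        · have hcard := Finset.card_insert_of_notMem hv
          have := ih (by omega) (by omega) hi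
          rw [hcard] at this
          push_cast at this
          rwa [show (α.card : ℝ) + 1 + 2 = α.card + 3 by ring] at this
        · intro g _
          simp [pairSum_indepSets_of_not_isIndepSet k hi])
    have hγ : 1 / ((α.card : ℝ) + 3) / (1 - 1 / ((α.card : ℝ) + 3)) = 1 / (α.card + 2) := by
      have : (α.card : ℝ) + 3 - 1 = α.card + 2 := by ring
      rw [one_sub_div (by positivity), this]
      field_simp
    rwa [hγ] at h

end Graph

/-! ### The down-up walk as a quadratic form. -/

section Walk

variable {V : Type*} [Fintype V] [DecidableEq V]

open scoped Matrix

omit [Fintype V] in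
theorem upSum_of_card_eq {T : Finset (Finset V)} {k : ℕ} (hT : ∀ τ ∈ T, τ.card = k)
    (f : Finset V → ℝ) {β : Finset V} (hβ : β.card = k) :
    upSum T f β = if β ∈ T then f β else 0 := by
  have : T.filter (fun τ => β ⊆ τ) = T.filter (fun τ => β = τ) :=
    Finset.filter_congr fun τ hτ =>
      ⟨fun h => Finset.eq_of_subset_of_card_le h (by rw [hβ, hT τ hτ]), fun h => h.le⟩
  rw [upSum, this, Finset.sum_filter, Finset.sum_ite_eq]

theorem levelMoment_top {T : Finset (Finset V)} {k : ℕ} (hT : ∀ τ ∈ T, τ.card = k)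
    (f : Finset V → ℝ) : levelMoment T f k k = ∑ τ ∈ T, f τ ^ 2 := by
  rw [levelMoment, Nat.choose_self, Nat.cast_one, div_one]
  have : T ⊆ Finset.powersetCard k Finset.univ := fun τ hτ =>
    Finset.mem_powersetCard.mpr ⟨Finset.subset_univ _, hT τ hτ⟩
  rw [← Finset.sum_subset this]
  · refine Finset.sum_congr rfl fun τ hτ => ?_
    rw [sqRatio, upSum_of_card_eq hT _ (hT τ hτ), upSum_of_card_eq hT _ (hT τ hτ)]
    simp [hτ]
  · intro β hβ hβT
    have hc := (Finset.mem_powersetCard.mp hβ).2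
    rw [sqRatio, upSum_of_card_eq hT _ hc, if_neg hβT]
    simp

theorem levelMoment_zero {T : Finset (Finset V)} {k : ℕ} (f : Finset V → ℝ)
    (hf : ∑ τ ∈ T, f τ = 0) : levelMoment T f k 0 = 0 := by
  simp [levelMoment, sqRatio, upSum, hf]

/-- Since the top distribution is uniform, its normalising constant cancels from the ratio of
marginals. The resulting kernel is visibly symmetric, which gives the real spectrum. -/
theorem independentSetWalk_apply (G : SimpleGraph V) (r : ℕ)
    (β β' : (HDX.independentSetComplex G (r + 1)).Face (r + 1)) :
    HDX.independentSetWalk G (r + 1) β β' = ∑ α ∈ (HDX.independentSetComplex G (r + 1)).facesOfCard r,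
      (if α ⊆ β.1 then 1 else 0) * (if α ⊆ β'.1 then 1 else 0)
        / (((r : ℝ) + 1) * upSum (indepSets G (r + 1)) 1 α) := by
  have hT : (HDX.independentSetComplex G (r + 1)).facesOfCard (r + 1) = indepSets G (r + 1) := rfl
  change (HDX.Complex.downUpWalk _ _ (r + 1) r) β β' = _
  rw [HDX.Complex.downUpWalk, Matrix.mul_apply]
  refine Eq.trans ?_ (Finset.sum_coe_sort ((HDX.independentSetComplex G (r + 1)).facesOfCard r) _)
  refine Finset.sum_congr rfl fun α _ => ?_
  have hcard : α.1.card = r := (Finset.mem_filter.mp α.2).2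
  have htop : (HDX.independentSetComplex G (r + 1)).marginal
      ((HDX.independentSetComplex G (r + 1)).uniformWeight (r + 1)) (r + 1) (r + 1) β'.1
      = 1 / ((indepSets G (r + 1)).card : ℝ) := by
    rw [HDX.Complex.marginal, Nat.sub_self, HDX.Complex.marginalOfCodim,
      HDX.Complex.uniformWeight, if_pos β'.2, hT]
  have hmid : (HDX.independentSetComplex G (r + 1)).marginal
      ((HDX.independentSetComplex G (r + 1)).uniformWeight (r + 1)) (r + 1) r α.1
      = 1 / ((r : ℝ) + 1) * (upSum (indepSets G (r + 1)) 1 α.1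
        * (1 / ((indepSets G (r + 1)).card : ℝ))) := by
    rw [HDX.Complex.marginal, Nat.add_sub_cancel_left, HDX.Complex.marginalOfCodim]
    beta_reduce
    rw [hcard, hT, upSum, Finset.sum_mul]
    congr 1
    refine Finset.sum_congr rfl fun τ hτ => ?_
    have hτT : τ ∈ indepSets G (r + 1) := (Finset.mem_filter.mp hτ).1
    rw [HDX.Complex.marginalOfCodim, HDX.Complex.uniformWeight, hT, if_pos hτT]
    simp
  have hne : ((indepSets G (r + 1)).card : ℝ) ≠ 0 := by
    have : β'.1 ∈ indepSets G (r + 1) := β'.2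
    exact_mod_cast (Finset.card_pos.mpr ⟨_, this⟩).ne'
  have hr : (r : ℝ) + 1 ≠ 0 := by positivity
  rw [HDX.Complex.upOperator, HDX.Complex.downOperator, htop, hmid]
  split_ifs
  · field_simp
  all_goals simp

theorem independentSetWalk_isSymm (G : SimpleGraph V) (r : ℕ) :
    (HDX.independentSetWalk G (r + 1)).IsSymm := by
  ext β β'
  rw [Matrix.transpose_apply]
  rw [independentSetWalk_apply, independentSetWalk_apply]
  exact Finset.sum_congr rfl fun α _ => by rw [mul_comm (ite _ _ _)]

/-- Summing the kernel over `β` and `β'` first leaves the square of `upSum` for each `α`. The factor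
`1/(r+1)` is the binomial normalisation at level `r`, and non-independent `α` contribute nothing. -/
theorem independentSetWalk_quadratic (G : SimpleGraph V) (r : ℕ) (f : Finset V → ℝ) :
    (fun β : (HDX.independentSetComplex G (r + 1)).Face (r + 1) => f β.1) ⬝ᵥ
      HDX.independentSetWalk G (r + 1) *ᵥ (fun β => f β.1)
      = levelMoment (indepSets G (r + 1)) f (r + 1) r := by
  have hup : ∀ α : Finset V, upSum (indepSets G (r + 1)) f α
      = ∑ β : (HDX.independentSetComplex G (r + 1)).Face (r + 1),
        (if α ⊆ β.1 then 1 else 0) * f β.1 := by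
    intro α
    rw [Finset.sum_coe_sort ((HDX.independentSetComplex G (r + 1)).facesOfCard (r + 1))
      (fun τ => (if α ⊆ τ then 1 else 0) * f τ)]
    simp only [upSum, Finset.sum_filter, ite_mul, one_mul, zero_mul]
    rfl
  have hsub : (HDX.independentSetComplex G (r + 1)).facesOfCard r
      ⊆ Finset.powersetCard r Finset.univ := fun α hα =>
    Finset.mem_powersetCard.mpr ⟨Finset.subset_univ _, (Finset.mem_filter.mp hα).2⟩
  have hch : (((r + 1).choose r : ℕ) : ℝ) = r + 1 := by
    rw [Nat.choose_succ_self_right]; push_cast; rfl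
  rw [levelMoment, hch, ← Finset.sum_subset hsub, Finset.sum_div]
  · simp only [dotProduct, Matrix.mulVec, Finset.mul_sum]
    have : ∀ β β' : (HDX.independentSetComplex G (r + 1)).Face (r + 1),
        f β.1 * (HDX.independentSetWalk G (r + 1) β β' * f β'.1)
        = ∑ α ∈ (HDX.independentSetComplex G (r + 1)).facesOfCard r,
          ((if α ⊆ β.1 then 1 else 0) * f β.1) * ((if α ⊆ β'.1 then 1 else 0) * f β'.1)
            / (((r : ℝ) + 1) * upSum (indepSets G (r + 1)) 1 α) := by
      intro β β'
      rw [independentSetWalk_apply, Finset.sum_mul, Finset.mul_sum]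
      exact Finset.sum_congr rfl fun α _ => by ring
    refine (Finset.sum_congr rfl fun β _ => Finset.sum_congr rfl fun β' _ => this β β').trans ?_
    refine (Finset.sum_congr rfl fun β _ => Finset.sum_comm).trans (Finset.sum_comm.trans ?_)
    refine Finset.sum_congr rfl fun α _ => ?_
    simp only [← Finset.sum_div, ← Finset.mul_sum, ← Finset.sum_mul]
    rw [sqRatio, div_div, mul_comm ((r : ℝ) + 1), pow_two, hup]
    rfl
  · intro α hα hαn
    have : upSum (indepSets G (r + 1)) f α = 0 := by
      refine Finset.sum_eq_zero fun τ hτ => absurd ?_ hαn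
      rw [Finset.mem_filter, mem_indepSets] at hτ
      rw [mem_facesOfCard_independentSetComplex (Nat.le_succ r)]
      exact ⟨hτ.1.1.mono (by exact_mod_cast hτ.2), (Finset.mem_powersetCard.mp hα).2⟩
    rw [sqRatio, this]
    simp

theorem independentSetComplex_isPure {G : SimpleGraph V} [DecidableRel G.Adj] {k : ℕ}
    (hk : k * (G.maxDegree + 1) ≤ Fintype.card V) :
    (HDX.independentSetComplex G k).IsPure k := by
  refine ⟨⟨∅, mem_faces_independentSetComplex.mpr (by simp [SimpleGraph.IsIndepSet])⟩, ?_⟩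
  intro α hα hmax
  rw [mem_faces_independentSetComplex] at hα
  obtain ⟨τ, hτ, hs⟩ := exists_indepSets_superset hk hα.1 hα.2
  rw [mem_indepSets] at hτ
  rw [← hmax τ (mem_faces_independentSetComplex.mpr ⟨hτ.1, hτ.2.le⟩) hs, hτ.2]

end Walk

theorem theoremt {V : Type*} [Fintype V] [DecidableEq V] (G : SimpleGraph V)
    [DecidableRel G.Adj] (k : ℕ) (hk1 : 1 ≤ k) (hkV : k ≤ Fintype.card V)
    (hk : (k : ℝ) * ((G.maxDegree : ℝ) + |HDX.eigenvalueMin (G.adjMatrix ℝ)|)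
      ≤ (Fintype.card V : ℝ)) :
    (HDX.independentSetComplex G k).IsPure k ∧
    HDX.HasRealSpectrum (HDX.independentSetWalk G k) ∧
    HDX.eigenvalue (HDX.independentSetWalk G k) 2 ≤ 1 - 1 / (k : ℝ) ^ 2 := by
  refine ⟨independentSetComplex_isPure (mul_maxDegree_add_one_le hkV hk), ?_⟩
  -- Removes the truncated subtraction: `k - 1` in the walk becomes `r`.
  obtain ⟨r, rfl⟩ : ∃ r, k = r + 1 := ⟨k - 1, by omega⟩
  have hsymm := independentSetWalk_isSymm G r
  have hk2 : (0 : ℝ) < ((r + 1 : ℕ) : ℝ) ^ 2 := by positivity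
  refine ⟨hasRealSpectrum_of_isSymm _ hsymm, eigenvalue_two_le _ hsymm (fun _ => 1) _ ?_ fun f hf => ?_⟩
  · rw [sub_nonneg, div_le_one hk2]
    exact one_le_pow₀ (by exact_mod_cast hk1)
  · have hT := card_of_mem_indepSets G (r + 1)
    -- Extend `f` by zero to all finsets, the domain on which the moments are defined.
    obtain ⟨F, hF⟩ : ∃ F : Finset V → ℝ, f = fun β => F β.1 :=
      ⟨fun τ => if h : τ ∈ (HDX.independentSetComplex G (r + 1)).facesOfCard (r + 1)
        then f ⟨τ, h⟩ else 0, funext fun β => by simp⟩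
    subst hF
    have hsum : ∑ τ ∈ indepSets G (r + 1), F τ = 0 := by
      rw [← Finset.sum_coe_sort, ← hf]
      simp only [dotProduct, one_mul]
      rfl
    have hgap := levelMoment_gap hT hk1 F fun α hα => secondEigenvalueLE_indepSets hkV hk hα
    rw [levelMoment_zero F hsum, sub_zero, Nat.add_sub_cancel,
      ← independentSetWalk_quadratic, levelMoment_top hT] at hgap
    have hnorm : dotProduct (fun β : (HDX.independentSetComplex G (r + 1)).Face (r + 1) => F β.1)
        (fun β => F β.1) = ∑ τ ∈ indepSets G (r + 1), F τ ^ 2 := by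
      rw [← Finset.sum_coe_sort]
      simp only [dotProduct, ← pow_two]
      rfl
    refine le_of_le_of_eq ?_ (congrArg _ hnorm.symm)
    rw [sub_mul, one_mul, one_div, inv_mul_eq_div, le_sub_comm, div_le_iff₀ hk2, mul_comm]
    exact hgap
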